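/- Let $\mathbb F$ be a field and let $q\in\mathbb F$ be nonzero and not a root of unity. Put $[3]_q=(q^3-q^{-3})/(q-q^{-1})$. Let $\square_q$ be the unital associative $\mathbb F$-algebra with generators $x_i$ $(i\in\mathbb Z/4\mathbb Z)$ and relations, for all $i\in\mathbb Z/4\mathbb Z$, $$\frac{q x_i x_{i+1}-q^{-1}x_{i+1}x_i}{q-q^{-1}}=1,\qquad x_i^3x_{i+2}-[3]_q\,x_i^2x_{i+2}x_i+[3]_q\,x_ix_{i+2}x_i^2-x_{i+2}x_i^3=0.$$ A vector $\xi$ of a $\square_q$-module $V$ is called NIL if $x_1\xi=0$, $x_3\xi=0$ and $\xi\neq 0$. We say that $\xi$ generates $V$ if no proper $\square_q$-submodule of $V$ contains $\xi$, and $V$ is called NIL if it is generated by a NIL vector. A NIL $\square_q$-module exists, and any two NIL $\square_q$-modules are isomorphic. Let $\mathbf U$ denote a NIL $\square_q$-module. Then $\mathbf U$ has a unique sequence of $\mathbb F$-subspaces $\{\mathbf U_n\}_{n\in\mathbb N}$, $\mathbb N=\{0,1,2,\ldots\}$, such that (i) $\mathbf U_0\neq 0$; (ii) the sum $\mathbf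 U=\sum_{n\in\mathbb N}\mathbf U_n$ is direct; (iii) for all $n\in\mathbb N$, $x_0\mathbf U_n\subseteq\mathbf U_{n+1}$, $x_1\mathbf U_n\subseteq\mathbf U_{n-1}$, $x_2\mathbf U_n\subseteq\mathbf U_{n+1}$, $x_3\mathbf U_n\subseteq\mathbf U_{n-1}$, where $\mathbf U_{-1}=0$. Moreover, $\mathbf U_0$ has dimension $1$; the nonzero vectors in $\mathbf U_0$ are precisely the NIL vectors in $\mathbf U$, and each of these vectors generates $\mathbf U$. If $\xi$ is a NIL vector in $\mathbf U$, then for every $n\in\mathbb N$ the subspace $\mathbf U_n$ is spanned by the vectors $u_1u_2\cdots u_n\xi$ with $u_i\in\{x_0,x_2\}$ for $1\le i\le n$. -/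

import Mathlib

universe u v w

/-- The `q`-integer `[n]_q = (q^n - q^{-n}) / (q - q^{-1})`. -/
def qInt {F : Type u} [Field F] (q : F) (n : ℤ) : F :=
  (q ^ n - q ^ (-n)) / (q - q⁻¹)

/-- The defining relations of `□_q` on the free algebra with generators indexed by `ℤ/4ℤ`. -/
inductive SquareRel (F : Type u) [Field F] (q : F) :
    FreeAlgebra F (ZMod 4) → FreeAlgebra F (ZMod 4) → Prop
  | qWeyl (i : ZMod 4) :
      SquareRel F q
        ((q - q⁻¹)⁻¹ •
          (q • (FreeAlgebra.ι F i * FreeAlgebra.ι F (i + 1))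
            - q⁻¹ • (FreeAlgebra.ι F (i + 1) * FreeAlgebra.ι F i)))
        1
  | qSerre (i : ZMod 4) :
      SquareRel F q
        (FreeAlgebra.ι F i ^ 3 * FreeAlgebra.ι F (i + 2)
          - qInt q 3 • (FreeAlgebra.ι F i ^ 2 * FreeAlgebra.ι F (i + 2) * FreeAlgebra.ι F i)
          + qInt q 3 • (FreeAlgebra.ι F i * FreeAlgebra.ι F (i + 2) * FreeAlgebra.ι F i ^ 2)
          - FreeAlgebra.ι F (i + 2) * FreeAlgebra.ι F i ^ 3)
        0

/-- The algebra `□_q`. -/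
abbrev SquareAlgebra (F : Type u) [Field F] (q : F) : Type u :=
  RingQuot (SquareRel F q)

/-- The generators `x_i` of `□_q`, for `i ∈ ℤ/4ℤ`. -/
def SquareAlgebra.x (F : Type u) [Field F] (q : F) (i : ZMod 4) : SquareAlgebra F q :=
  RingQuot.mkAlgHom F (SquareRel F q) (FreeAlgebra.ι F i)

section Modules

variable (F : Type u) [Field F] (q : F)
variable {V : Type v} [AddCommGroup V] [Module F V] [Module (SquareAlgebra F q) V]

/-- The `□_q`-module `V` is generated by `ξ`: no proper `□_q`-submodule contains `ξ`. -/
def IsGeneratedBy (ξ : V) : Prop :=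
  ∀ W : Submodule (SquareAlgebra F q) V, ξ ∈ W → W = ⊤

/-- NIL vectors: nonzero vectors sent to zero by `x_1` and `x_3`. -/
def IsNILVector (ξ : V) : Prop :=
  SquareAlgebra.x F q 1 • ξ = 0 ∧ SquareAlgebra.x F q 3 • ξ = 0 ∧ ξ ≠ 0

variable (V) in
/-- NIL modules: those generated by a NIL vector. -/
def IsNILModule : Prop :=
  ∃ ξ : V, IsNILVector F q ξ ∧ IsGeneratedBy F q ξ

variable {F} in
/-- The subspace `U_{n-1}`, with the convention `U_{-1} = 0`. -/
def prevSubspace (U : ℕ → Submodule F V) : ℕ → Submodule F V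
  | 0 => ⊥
  | n + 1 => U n

/-- The conditions on a sequence of subspaces `U_n`: `U_0` is nonzero, `V` is the direct sum of
the `U_n`, the generators `x_0`, `x_2` raise the index by one, and `x_1`, `x_3` lower it by one. -/
structure IsNILDecomposition (U : ℕ → Submodule F V) : Prop where
  zero_ne_bot : U 0 ≠ ⊥
  isInternal : DirectSum.IsInternal U
  x_zero_smul_mem : ∀ n, ∀ y ∈ U n, SquareAlgebra.x F q 0 • y ∈ U (n + 1)
  x_one_smul_mem : ∀ n, ∀ y ∈ U n, SquareAlgebra.x F q 1 • y ∈ prevSubspace U n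
  x_two_smul_mem : ∀ n, ∀ y ∈ U n, SquareAlgebra.x F q 2 • y ∈ U (n + 1)
  x_three_smul_mem : ∀ n, ∀ y ∈ U n, SquareAlgebra.x F q 3 • y ∈ prevSubspace U n

/-- The vectors `u_1 u_2 ⋯ u_n ξ` with each `u_i` one of `x_0`, `x_2`. -/
def wordVectors (ξ : V) (n : ℕ) : Set V :=
  {y | ∃ u : Fin n → SquareAlgebra F q,
    (∀ i, u i = SquareAlgebra.x F q 0 ∨ u i = SquareAlgebra.x F q 2) ∧
      y = (List.ofFn u).prod • ξ}

end Modules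

/-!
Write `U⁺` for the positive part of `U_q(ŝl₂)`. The algebra `□_q` acts on `U⁺`: `x₀` and `x₂` act as
the left multiplications by the two generators, `x₁` and `x₃` as the skew derivations
`(1 - q²)(∂_k - q⁻² ∂'_{!k})`, where `∂` and `∂'` are the left and right derivations of `U⁺`; the
unit is a NIL vector. If `ξ` is a NIL vector of a module, then `w ↦ w ξ` is a homomorphism from `U⁺`
to that module. Everything follows once the elements of `U⁺` killed by both lowering operators are
known to be the scalars.

Suppose both lowering operators kill `v`. Then, up to a power of `q`, the constant term left by a
word of `n` left derivations applied to `v` is unchanged when a letter of the word is moved from one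
end to the other and swapped. Two full turns restore the word and contribute `q^{-4n} ≠ 1`, so the
constant term vanishes. It remains to see, after Lusztig, that only scalars are killed by both left
derivations. A counterexample of minimal length is primitive for the braided coproduct, so the
braided antipode `S` sends it to its negative and `S²` fixes it; but `S²` multiplies degree `(a, b)`
by `q^{2((a - b)² - (a + b))}`. It is also a lowest weight vector for two locally nilpotent actions
of `U_q(sl₂)`, which forces `a = b`, and hence `a + b = 0`.
-/

/-! ### The cubic `q`-Serre relation -/

/-- The cubic `q`-Serre expression `a³b - [3]_q a²ba + [3]_q aba² - ba³` in an algebra. -/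
def qSerre {F : Type u} [Field F] (q : F) {R : Type v} [Ring R] [Algebra F R] (a b : R) : R :=
  a ^ 3 * b - qInt q 3 • (a ^ 2 * b * a) + qInt q 3 • (a * b * a ^ 2) - b * a ^ 3

/-- A nonzero scalar that is not a root of unity, as a class so that the representation of `□_q`
constructed below can be a `Module` instance. -/
class IsGeneric {F : Type u} [Field F] (q : F) : Prop where
  ne_zero : q ≠ 0
  pow_ne_one : ∀ n : ℕ, 0 < n → q ^ n ≠ 1

namespace IsGeneric

variable {F : Type u} [Field F] {q : F} [IsGeneric q]

theorem sq_ne_zero : q ^ 2 ≠ 0 := pow_ne_zero 2 ne_zero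

theorem sq_ne_one : q ^ 2 ≠ 1 := pow_ne_one 2 two_pos

theorem sub_inv_ne_zero : q - q⁻¹ ≠ 0 := by
  have h0 : q ≠ 0 := ne_zero
  intro h
  refine sq_ne_one (q := q) ?_
  rw [pow_two, ← mul_inv_cancel₀ h0, ← sub_eq_zero.1 h]

theorem qInt_three : qInt q 3 = q ^ 2 + 1 + (q ^ 2)⁻¹ := by
  have h0 : q ≠ 0 := ne_zero
  rw [qInt, div_eq_iff sub_inv_ne_zero, zpow_neg, show q ^ (3 : ℤ) = q ^ 3 by norm_cast]
  field_simp
  ring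

theorem pow_injective : Function.Injective fun n : ℕ => q ^ n := by
  intro m n hmn
  wlog hle : m ≤ n generalizing m n
  · exact (this hmn.symm (by omega)).symm
  by_contra hne
  refine pow_ne_one (q := q) (n - m) (by omega) ?_
  rw [pow_sub₀ _ ne_zero hle, ← show q ^ m = q ^ n from hmn]
  exact mul_inv_cancel₀ (pow_ne_zero _ ne_zero)

end IsGeneric

open scoped TensorProduct

section Serre

variable {F : Type u} [Field F] {q t : F} {R : Type v} [Ring R] [Algebra F R]
  {R' : Type w} [Ring R'] [Algebra F R']

theorem qSerre_smul_smul (a b : F) (x y : R) :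
    qSerre q (a • x) (b • y) = (a ^ 3 * b) • qSerre q x y := by
  simp only [qSerre, pow_succ, pow_zero, one_mul, smul_mul_assoc, mul_smul_comm, smul_smul,
    mul_assoc]
  module

theorem map_qSerre (φ : R →ₐ[F] R') (x y : R) : φ (qSerre q x y) = qSerre q (φ x) (φ y) := by
  simp [qSerre]

theorem qSerre_zero_zero : qSerre q (0 : R) 0 = 0 := by simp [qSerre]

theorem qSerre_tmul_of_commute {a b : R} (h : Commute a b) (x y : R') :
    qSerre q (a ⊗ₜ[F] x) (b ⊗ₜ[F] y) = (a ^ 3 * b) ⊗ₜ[F] qSerre q x y := by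
  have hba : ∀ z, b * (a * z) = a * (b * z) := fun z => (h.left_comm z).symm
  simp only [qSerre, pow_succ, pow_zero, one_mul, Algebra.TensorProduct.tmul_mul_tmul,
    TensorProduct.tmul_sub, TensorProduct.tmul_add, mul_assoc, hba, ← h.eq,
    ← TensorProduct.tmul_smul]

theorem qSerre_tmul_one (a b : R) :
    qSerre q (a ⊗ₜ[F] (1 : R')) (b ⊗ₜ[F] (1 : R')) = qSerre q a b ⊗ₜ[F] 1 :=
  (map_qSerre (Algebra.TensorProduct.includeLeft : R →ₐ[F] R ⊗[F] R') a b).symm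

theorem qSerre_single {A : Type w} [AddCommMonoid A] (α β : A) (x y : R) :
    qSerre q (AddMonoidAlgebra.single α x) (AddMonoidAlgebra.single β y) =
      AddMonoidAlgebra.single (3 • α + β) (qSerre q x y) := by
  have aaba : α + α + β + α = 3 • α + β := by abel
  have abaa : α + β + (α + α) = 3 • α + β := by abel
  have baaa : β + (α + α + α) = 3 • α + β := by abel
  have aaab : α + α + α + β = 3 • α + β := by abel
  simp only [qSerre, pow_succ, pow_zero, one_mul, AddMonoidAlgebra.single_mul_single,
    AddMonoidAlgebra.single_add, AddMonoidAlgebra.single_sub, ← AddMonoidAlgebra.smul_single,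
    aaba, abaa, baaa, aaab]

/-- The commutation rules are those of a braided tensor product, where `t` is `q²` or `q⁻²`, the two
scalars with `[3]_q = t + 1 + t⁻¹`; all cross terms cancel. -/
theorem qSerre_add (ht : t ≠ 0) (hqt : qInt q 3 = t + 1 + t⁻¹) {a b a' b' : R}
    (haa : a' * a = t • (a * a')) (hab : a' * b = t⁻¹ • (b * a')) (hba : b' * a = t⁻¹ • (a * b')) :
    qSerre q (a + a') (b + b') = qSerre q a b + qSerre q a' b' := by
  have haa' : ∀ z, a' * (a * z) = t • (a * (a' * z)) := fun z => by
    rw [← mul_assoc, haa, smul_mul_assoc, mul_assoc]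
  have hab' : ∀ z, a' * (b * z) = t⁻¹ • (b * (a' * z)) := fun z => by
    rw [← mul_assoc, hab, smul_mul_assoc, mul_assoc]
  have hba' : ∀ z, b' * (a * z) = t⁻¹ • (a * (b' * z)) := fun z => by
    rw [← mul_assoc, hba, smul_mul_assoc, mul_assoc]
  simp only [qSerre, hqt, pow_succ, pow_zero, one_mul, mul_add, add_mul, mul_assoc,
    haa, hab, hba, haa', hab', hba', smul_mul_assoc, mul_smul_comm, smul_smul, smul_add]
  match_scalars <;> field_simp <;> ring

theorem qSerre_mul_of_skew (ht : t ≠ 0) (hqt : qInt q 3 = t + 1 + t⁻¹) {x y l : R} {c d : F}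
    (hx : x * l = c • 1 + t • (l * x)) (hy : y * l = d • 1 + t⁻¹ • (l * y)) :
    qSerre q x y * l = t ^ 2 • (l * qSerre q x y) := by
  have hx' : ∀ z, x * (l * z) = c • z + t • (l * (x * z)) := fun z => by
    rw [← mul_assoc, hx, add_mul, smul_mul_assoc, one_mul, smul_mul_assoc, mul_assoc]
  have hy' : ∀ z, y * (l * z) = d • z + t⁻¹ • (l * (y * z)) := fun z => by
    rw [← mul_assoc, hy, add_mul, smul_mul_assoc, one_mul, smul_mul_assoc, mul_assoc]
  simp only [qSerre, hqt, pow_succ, pow_zero, one_mul, mul_add, add_mul, mul_sub,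
    sub_mul, mul_assoc, hx, hy, hx', hy', smul_mul_assoc, mul_smul_comm, smul_smul, smul_add,
    smul_sub, mul_one]
  match_scalars <;> field_simp <;> ring

theorem qSerre_lowerTriangular (ht : t ≠ 0) (hqt : qInt q 3 = t + 1 + t⁻¹) (x y : R) (c d : F) :
    qSerre q !![x, 0; c • 1, t • x] !![y, 0; d • 1, t⁻¹ • y] =
      !![qSerre q x y, 0; 0, qSerre q (t • x) (t⁻¹ • y)] := by
  simp only [qSerre, hqt, pow_succ, pow_zero, one_mul, Matrix.mul_fin_two, Matrix.smul_of,
    Matrix.of_sub_of, Matrix.of_add_of, Matrix.smul_cons, Matrix.smul_empty, Matrix.cons_sub_cons,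
    Matrix.cons_add_cons, Matrix.empty_add_empty, Matrix.empty_sub_empty]
  congr! 3
  · simp only [mul_zero, zero_mul, add_zero, mul_assoc]
  · simp only [mul_zero, zero_mul, add_zero, sub_zero, smul_zero]
  · simp only [mul_zero, zero_mul, smul_zero, zero_add, mul_one, one_mul, smul_mul_assoc,
      mul_smul_comm, mul_assoc, add_mul, mul_add]
    congr! 1
    match_scalars <;> field_simp <;> ring

end Serre

/-! ### The positive part of `U_q(ŝl₂)` and its skew derivations -/

/-- The relations of the positive part of `U_q(ŝl₂)`. -/
inductive UqPlusRel (F : Type u) [Field F] (q : F) :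
    FreeAlgebra F Bool → FreeAlgebra F Bool → Prop
  | serre (i : Bool) : UqPlusRel F q (qSerre q (FreeAlgebra.ι F i) (FreeAlgebra.ι F (!i))) 0

/-- The positive part of `U_q(ŝl₂)`, with its two generators indexed by `Bool`. -/
def UqPlus (F : Type u) [Field F] (q : F) : Type u := RingQuot (UqPlusRel F q)

instance (F : Type u) [Field F] (q : F) : Ring (UqPlus F q) :=
  inferInstanceAs (Ring (RingQuot (UqPlusRel F q)))

instance (F : Type u) [Field F] (q : F) : Algebra F (UqPlus F q) :=
  inferInstanceAs (Algebra F (RingQuot (UqPlusRel F q)))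

namespace UqPlus

variable {F : Type u} [Field F] {q : F} {R : Type v} [Ring R] [Algebra F R]

/-- The generators of `UqPlus F q`. -/
def gen (F : Type u) [Field F] (q : F) (i : Bool) : UqPlus F q :=
  RingQuot.mkAlgHom F (UqPlusRel F q) (FreeAlgebra.ι F i)

theorem qSerre_gen (i : Bool) : qSerre q (gen F q i) (gen F q (!i)) = 0 := by
  have h := RingQuot.mkAlgHom_rel F (UqPlusRel.serre (F := F) (q := q) i)
  rwa [map_qSerre, map_zero] at h

/-- The universal property of `UqPlus F q`. -/
def lift (g : Bool → R) (h : ∀ i, qSerre q (g i) (g (!i)) = 0) : UqPlus F q →ₐ[F] R :=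
  RingQuot.liftAlgHom F ⟨FreeAlgebra.lift F g, by
    rintro _ _ ⟨i⟩
    rw [map_qSerre, map_zero, FreeAlgebra.lift_ι_apply, FreeAlgebra.lift_ι_apply, h]⟩

@[simp]
theorem lift_gen (g : Bool → R) (h : ∀ i, qSerre q (g i) (g (!i)) = 0) (i : Bool) :
    lift g h (gen F q i) = g i :=
  (RingQuot.liftAlgHom_mkAlgHom_apply F _ _ _).trans (FreeAlgebra.lift_ι_apply _ _)

theorem adjoin_range_gen : Algebra.adjoin F (Set.range (gen F q)) = ⊤ := by
  have h := congrArg (Subalgebra.map (RingQuot.mkAlgHom F (UqPlusRel F q)))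
    (FreeAlgebra.adjoin_range_ι F Bool)
  rw [AlgHom.map_adjoin, ← Set.range_comp, Algebra.map_top] at h
  exact h.trans ((AlgHom.range_eq_top _).2 (RingQuot.mkAlgHom_surjective F _))

theorem algHom_ext {f g : UqPlus F q →ₐ[F] R} (h : ∀ i, f (gen F q i) = g (gen F q i)) : f = g :=
  AlgHom.ext_of_adjoin_eq_top adjoin_range_gen (by rintro _ ⟨i, rfl⟩; exact h i)

theorem induction_left {P : UqPlus F q → Prop} (one : P 1) (add : ∀ a b, P a → P b → P (a + b))
    (smul : ∀ (c : F) a, P a → P (c • a)) (gen_mul : ∀ i a, P a → P (gen F q i * a))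
    (w : UqPlus F q) : P w := by
  suffices ∀ a, P a → P (w * a) by simpa only [mul_one] using this 1 one
  have hw : w ∈ Algebra.adjoin F (Set.range (gen F q)) := by
    rw [adjoin_range_gen]; exact Algebra.mem_top
  induction hw using Algebra.adjoin_induction with
  | mem x hx => obtain ⟨i, rfl⟩ := hx; exact gen_mul i
  | algebraMap c => intro a ha; rw [← Algebra.smul_def]; exact smul c a ha
  | add x y _ _ hx hy => intro a ha; rw [add_mul]; exact add _ _ (hx a ha) (hy a ha)
  | mul x y _ _ hx hy => intro a ha; rw [mul_assoc]; exact hx _ (hy a ha)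

theorem induction_right {P : UqPlus F q → Prop} (one : P 1) (add : ∀ a b, P a → P b → P (a + b))
    (smul : ∀ (c : F) a, P a → P (c • a)) (mul_gen : ∀ i a, P a → P (a * gen F q i))
    (w : UqPlus F q) : P w := by
  suffices ∀ a, P a → P (a * w) by simpa only [one_mul] using this 1 one
  have hw : w ∈ Algebra.adjoin F (Set.range (gen F q)) := by
    rw [adjoin_range_gen]; exact Algebra.mem_top
  induction hw using Algebra.adjoin_induction with
  | mem x hx => obtain ⟨i, rfl⟩ := hx; exact mul_gen i
  | algebraMap c =>
    intro a ha; rw [← Algebra.commutes, ← Algebra.smul_def]; exact smul c a ha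
  | add x y _ _ hx hy => intro a ha; rw [mul_add]; exact add _ _ (hx a ha) (hy a ha)
  | mul x y _ _ hx hy => intro a ha; rw [← mul_assoc]; exact hy _ (hx a ha)

theorem linearMap_ext {M : Type v} [AddCommGroup M] [Module F M] {f g : UqPlus F q →ₗ[F] M}
    (one : f 1 = g 1) (gen_mul : ∀ i a, f a = g a → f (gen F q i * a) = g (gen F q i * a)) :
    f = g := by
  ext w
  induction w using induction_left with
  | one => exact one
  | add a b ha hb => rw [map_add, map_add, ha, hb]
  | smul c a ha => rw [map_smul, map_smul, ha]
  | gen_mul i a ha => exact gen_mul i a ha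

/-- The scalar `q^⟨αᵢ, αⱼ⟩`, where `⟨αᵢ, αⱼ⟩ = ±2` is an entry of the Cartan matrix of `ŝl₂`. -/
def rootTwist (q : F) (i j : Bool) : F :=
  if i = j then q ^ 2 else (q ^ 2)⁻¹

@[simp]
theorem rootTwist_self (i : Bool) : rootTwist q i i = q ^ 2 := if_pos rfl

theorem rootTwist_comm (i j : Bool) : rootTwist q i j = rootTwist q j i := by
  simp only [rootTwist, eq_comm]

@[simp]
theorem rootTwist_not_left (i j : Bool) : rootTwist q (!i) j = (rootTwist q i j)⁻¹ := by
  cases i <;> cases j <;> simp [rootTwist]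

@[simp]
theorem rootTwist_not_right (i j : Bool) : rootTwist q i (!j) = (rootTwist q i j)⁻¹ := by
  rw [rootTwist_comm, rootTwist_not_left, rootTwist_comm]

/-- The automorphism of `UqPlus F q` given by conjugation with the Cartan element `K_k`. -/
def twist (k : Bool) : UqPlus F q →ₐ[F] UqPlus F q :=
  lift (fun j => rootTwist q k j • gen F q j) fun i => by
    rw [qSerre_smul_smul, qSerre_gen, smul_zero]

@[simp]
theorem twist_gen (k j : Bool) : twist k (gen F q j) = rootTwist q k j • gen F q j :=
  lift_gen _ _ _

theorem twist_comm (i j : Bool) (w : UqPlus F q) : twist i (twist j w) = twist j (twist i w) := by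
  have h : (twist i).comp (twist j) = (twist j).comp (twist (F := F) (q := q) i) :=
    algHom_ext fun k => by
      simp only [AlgHom.comp_apply, twist_gen, map_smul, smul_comm (rootTwist q i k)]
  exact DFunLike.congr_fun h w

/-- The augmentation of `UqPlus F q`, sending both generators to `0`. -/
def counit : UqPlus F q →ₐ[F] F :=
  lift (fun _ => 0) fun _ => qSerre_zero_zero

@[simp]
theorem counit_gen (i : Bool) : counit (gen F q i) = 0 := lift_gen _ _ _

section SkewDerivations

variable [IsGeneric q]

theorem rootTwist_ne_zero (i j : Bool) : rootTwist q i j ≠ 0 := by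
  have h : q ^ 2 ≠ 0 := IsGeneric.sq_ne_zero
  unfold rootTwist
  split_ifs
  exacts [h, inv_ne_zero h]

theorem twist_twist_not (k : Bool) (w : UqPlus F q) : twist k (twist (!k) w) = w := by
  suffices (twist k).comp (twist (!k)) = AlgHom.id F (UqPlus F q) from DFunLike.congr_fun this w
  exact algHom_ext fun i => by
    rw [AlgHom.comp_apply, twist_gen, map_smul, twist_gen, smul_smul, rootTwist_not_left,
      inv_mul_cancel₀ (rootTwist_ne_zero k i), one_smul, AlgHom.id_apply]

theorem qInt_three_eq_rootTwist (i j : Bool) :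
    qInt q 3 = rootTwist q i j + 1 + (rootTwist q i j)⁻¹ := by
  rw [IsGeneric.qInt_three, rootTwist]
  split_ifs
  · rfl
  · rw [inv_inv, add_right_comm, add_assoc, add_left_comm, ← add_assoc, add_right_comm]

/-- The representation `w ↦ (w, 0; D w, K_k w)` encoding the skew derivation `D` that takes the
value `c j` on the generator `j`. -/
def skewMatrix (k : Bool) (c : Bool → F) :
    UqPlus F q →ₐ[F] Matrix (Fin 2) (Fin 2) (UqPlus F q) :=
  lift (fun j => !![gen F q j, 0; c j • 1, rootTwist q k j • gen F q j]) fun i => by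
    rw [rootTwist_not_right, qSerre_lowerTriangular (rootTwist_ne_zero k i)
      (qInt_three_eq_rootTwist k i), qSerre_smul_smul, qSerre_gen, smul_zero]
    exact (Matrix.eta_fin_two 0).symm

theorem skewMatrix_eq (k : Bool) (c : Bool → F) (w : UqPlus F q) :
    skewMatrix k c w = !![w, 0; skewMatrix k c w 1 0, twist k w] := by
  induction w using induction_left with
  | one => rw [map_one, map_one]; exact Matrix.eta_fin_two 1
  | add a b ha hb =>
    rw [map_add, ha, hb]
    ext r s; fin_cases r <;> fin_cases s <;> simp
  | smul c a ha =>
    rw [map_smul, ha]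
    ext r s; fin_cases r <;> fin_cases s <;> simp
  | gen_mul i a ha =>
    rw [map_mul, ha, skewMatrix, lift_gen]
    ext r s; fin_cases r <;> fin_cases s <;> simp [Matrix.mul_apply]

/-- The skew derivation `D` with `D (a b) = D a b + K_k a D b` taking the value `c j` on the
generator `j`. -/
def skewDer (k : Bool) (c : Bool → F) : UqPlus F q →ₗ[F] UqPlus F q where
  toFun w := skewMatrix k c w 1 0
  map_add' a b := by rw [map_add, Matrix.add_apply]
  map_smul' a b := by rw [map_smul, Matrix.smul_apply, RingHom.id_apply]

theorem skewDer_mul (k : Bool) (c : Bool → F) (a b : UqPlus F q) :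
    skewDer k c (a * b) = skewDer k c a * b + twist k a * skewDer k c b := by
  change skewMatrix k c (a * b) 1 0 = _
  rw [map_mul, Matrix.mul_apply, Fin.sum_univ_two]
  nth_rw 2 [skewMatrix_eq]
  nth_rw 3 [skewMatrix_eq]
  rfl

@[simp]
theorem skewDer_one (k : Bool) (c : Bool → F) : skewDer k c (1 : UqPlus F q) = 0 := by
  change skewMatrix k c 1 1 0 = 0
  rw [map_one]
  rfl

@[simp]
theorem skewDer_gen (k : Bool) (c : Bool → F) (j : Bool) :
    skewDer k c (gen F q j) = c j • 1 := by
  change skewMatrix k c (gen F q j) 1 0 = c j • 1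
  rw [skewMatrix, lift_gen]
  rfl

theorem skewDer_gen_mul (k : Bool) (c : Bool → F) (j : Bool) (w : UqPlus F q) :
    skewDer k c (gen F q j * w) = c j • w + rootTwist q k j • (gen F q j * skewDer k c w) := by
  rw [skewDer_mul, skewDer_gen, twist_gen, smul_mul_assoc, one_mul, smul_mul_assoc]

/-- The left skew derivation dual to the generator `k`. -/
def derL (k : Bool) : UqPlus F q →ₗ[F] UqPlus F q := skewDer k (Pi.single k 1)

/-- The right skew derivation dual to the generator `k`, composed with `twist (!k)`. The composite
is again a left skew derivation, with the twist inverse to that of `derL k`. -/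
def derR (k : Bool) : UqPlus F q →ₗ[F] UqPlus F q := skewDer (!k) (Pi.single k 1)

@[simp]
theorem derL_one (k : Bool) : derL k (1 : UqPlus F q) = 0 := skewDer_one _ _

@[simp]
theorem derR_one (k : Bool) : derR k (1 : UqPlus F q) = 0 := skewDer_one _ _

theorem derL_mul (k : Bool) (a b : UqPlus F q) :
    derL k (a * b) = derL k a * b + twist k a * derL k b := skewDer_mul _ _ _ _

theorem derR_mul (k : Bool) (a b : UqPlus F q) :
    derR k (a * b) = derR k a * b + twist (!k) a * derR k b := skewDer_mul _ _ _ _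

theorem derL_gen_self (k : Bool) : derL k (gen F q k) = 1 := by
  rw [derL, skewDer_gen, Pi.single_eq_same, one_smul]

theorem derR_gen_self (k : Bool) : derR k (gen F q k) = 1 := by
  rw [derR, skewDer_gen, Pi.single_eq_same, one_smul]

theorem derL_gen_mul (k j : Bool) (w : UqPlus F q) :
    derL k (gen F q j * w) =
      (Pi.single k 1 : Bool → F) j • w + rootTwist q k j • (gen F q j * derL k w) :=
  skewDer_gen_mul _ _ _ _

theorem derR_gen_mul (k j : Bool) (w : UqPlus F q) :
    derR k (gen F q j * w) =
      (Pi.single k 1 : Bool → F) j • w + (rootTwist q k j)⁻¹ • (gen F q j * derR k w) := by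
  rw [← rootTwist_not_left]
  exact skewDer_gen_mul _ _ _ _

theorem skewDer_eq (k : Bool) (c : Bool → F) (w : UqPlus F q) :
    skewDer k c w = c k • derL k w + c (!k) • derR (!k) w := by
  suffices skewDer k c = c k • derL k + c (!k) • derR (F := F) (q := q) (!k) by rw [this]; rfl
  refine linearMap_ext (by simp) fun i a ha => ?_
  simp only [LinearMap.add_apply, LinearMap.smul_apply] at ha ⊢
  rw [skewDer_gen_mul, derL_gen_mul, derR_gen_mul, ha, rootTwist_not_left, inv_inv, mul_add,
    mul_smul_comm, mul_smul_comm]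
  cases i <;> cases k <;> simp <;> module

theorem skewDer_single_twist (k j i : Bool) (w : UqPlus F q) :
    skewDer k (Pi.single j 1) (twist i w) =
      rootTwist q i j • twist i (skewDer k (Pi.single j 1) w) := by
  suffices skewDer k (Pi.single j 1) ∘ₗ (twist i).toLinearMap =
      rootTwist q i j • (twist (F := F) i).toLinearMap ∘ₗ skewDer k (Pi.single j 1) from
    DFunLike.congr_fun this w
  refine linearMap_ext (by simp) fun l a ha => ?_
  simp only [LinearMap.comp_apply, LinearMap.smul_apply, AlgHom.toLinearMap_apply, map_mul,
    twist_gen, smul_mul_assoc, map_smul, skewDer_gen_mul, map_add, smul_add] at ha ⊢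
  rw [ha]
  congr 1
  · obtain rfl | h := eq_or_ne l j
    · rfl
    · simp only [Pi.single_eq_of_ne h, zero_smul, smul_zero]
  · simp only [mul_smul_comm, smul_smul]
    ring_nf

theorem derL_twist (k i : Bool) (w : UqPlus F q) :
    derL k (twist i w) = rootTwist q i k • twist i (derL k w) :=
  skewDer_single_twist _ _ _ _

theorem derR_twist (k i : Bool) (w : UqPlus F q) :
    derR k (twist i w) = rootTwist q i k • twist i (derR k w) :=
  skewDer_single_twist _ _ _ _

theorem derL_derR (k j : Bool) (w : UqPlus F q) :
    derL k (derR j w) = (rootTwist q k j)⁻¹ • derR j (derL k w) := by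
  suffices derL k ∘ₗ derR j = (rootTwist q k j)⁻¹ • derR j ∘ₗ derL (F := F) k from
    DFunLike.congr_fun this w
  refine linearMap_ext (by simp) fun i a ha => ?_
  have h0 : q ≠ 0 := IsGeneric.ne_zero
  simp only [LinearMap.comp_apply, LinearMap.smul_apply, derL_gen_mul, derR_gen_mul, map_add,
    map_smul, smul_add, smul_smul] at ha ⊢
  rw [ha]
  cases i <;> cases k <;> cases j <;>
    simp only [rootTwist, Pi.single_eq_same, ne_eq, Bool.false_eq_true,
      Bool.true_eq_false, not_false_eq_true, Pi.single_eq_of_ne, reduceIte, one_smul, zero_smul,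
      mul_one, mul_zero, zero_add, Algebra.mul_smul_comm] <;>
    match_scalars <;> field_simp

theorem counit_derR (k : Bool) (w : UqPlus F q) : counit (derR k w) = counit (derL k w) := by
  suffices counit.toLinearMap ∘ₗ derR k = counit.toLinearMap ∘ₗ derL (F := F) (q := q) k from
    DFunLike.congr_fun this w
  exact linearMap_ext (by simp) fun i a _ => by simp [derR_gen_mul, derL_gen_mul]

end SkewDerivations

/-! ### Rotating words of derivations -/

section Rotation

variable [IsGeneric q]

/-- The composite of the left skew derivations along a word, whose last letter acts first. -/
def derWord (l : List Bool) : Module.End F (UqPlus F q) := (l.map derL).prod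

@[simp]
theorem derWord_nil (w : UqPlus F q) : derWord [] w = w := rfl

@[simp]
theorem derWord_cons (k : Bool) (l : List Bool) (w : UqPlus F q) :
    derWord (k :: l) w = derL k (derWord l w) := by
  simp [derWord]

theorem derWord_concat (l : List Bool) (k : Bool) (w : UqPlus F q) :
    derWord (l ++ [k]) w = derWord l (derL k w) := by
  simp [derWord]

theorem derWord_derR (l : List Bool) (j : Bool) (w : UqPlus F q) :
    derWord l (derR j w) = (l.map fun k => (rootTwist q k j)⁻¹).prod • derR j (derWord l w) := by
  induction l with
  | nil => simp
  | cons k l ih =>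
    rw [derWord_cons, ih, map_smul, derL_derR, derWord_cons, smul_smul, List.map_cons,
      List.prod_cons, mul_comm]

variable {v : UqPlus F q} (hv : ∀ i, derL i v = (q ^ 2)⁻¹ • derR (!i) v)

include hv

theorem counit_derWord_concat (l : List Bool) (i : Bool) :
    counit (derWord (l ++ [i]) v) =
      ((q ^ 2)⁻¹ * (l.map (rootTwist q · i)).prod) * counit (derWord ((!i) :: l) v) := by
  simp only [derWord_concat, hv, map_smul, derWord_derR, counit_derR, smul_eq_mul, derWord_cons,
    rootTwist_not_right, inv_inv, mul_assoc]

theorem counit_derWord_append (m l : List Bool) :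
    counit (derWord (m ++ l) v) =
      ((q ^ 2)⁻¹ ^ l.length * (l.map fun i => (m.map (rootTwist q · i)).prod).prod) *
        counit (derWord (l.map (!·) ++ m) v) := by
  induction l generalizing m with
  | nil => simp
  | cons i l ih =>
    have cancel : (l.map (rootTwist q i)).prod * (l.map fun j => rootTwist q (!j) i).prod = 1 := by
      rw [← List.prod_map_mul]
      refine List.prod_eq_one fun x hx => ?_
      obtain ⟨j, -, rfl⟩ := List.mem_map.1 hx
      rw [rootTwist_not_left, rootTwist_comm, mul_inv_cancel₀ (rootTwist_ne_zero _ _)]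
    rw [List.append_cons, ih, ← List.append_assoc, counit_derWord_concat hv]
    simp only [List.map_append, List.map_map, List.map_cons, List.map_nil, List.prod_append,
      List.prod_cons, List.prod_nil, mul_one, List.prod_map_mul, List.length_cons, pow_succ,
      Function.comp_def, List.cons_append]
    linear_combination ((q ^ 2)⁻¹ ^ l.length * (q ^ 2)⁻¹ * (m.map (rootTwist q · i)).prod *
      (l.map fun j => (m.map (rootTwist q · j)).prod).prod *
      counit (derWord ((!i) :: (l.map (!·) ++ m)) v)) * cancel

theorem counit_derWord_eq_zero {l : List Bool} (hl : l ≠ []) : counit (derWord l v) = 0 := by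
  have turn (l : List Bool) :
      counit (derWord l v) = (q ^ 2)⁻¹ ^ l.length * counit (derWord (l.map (!·)) v) := by
    simpa using counit_derWord_append hv [] l
  have two_turns : counit (derWord l v) = (q ^ (4 * l.length))⁻¹ * counit (derWord l v) := by
    conv_lhs => rw [turn, turn, List.map_map, List.length_map,
      show ((!·) ∘ (!·) : Bool → Bool) = id from funext Bool.not_not, List.map_id, ← mul_assoc,
      ← mul_pow, ← mul_inv, ← pow_add, inv_pow, ← pow_mul]
  by_contra h
  refine IsGeneric.pow_ne_one (q := q) (4 * l.length)
    (Nat.mul_pos four_pos (List.length_pos_iff.2 hl)) (inv_eq_one.1 ?_)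
  exact mul_right_cancel₀ h (two_turns.symm.trans (one_mul _).symm)

end Rotation

end UqPlus

section Slice

variable {R : Type u} [CommRing R] {M M' N N' : Type*} [AddCommGroup M] [Module R M]
  [AddCommGroup M'] [Module R M'] [AddCommGroup N] [Module R N] [AddCommGroup N'] [Module R N']

/-- Applying a functional to the second factor of a tensor product. -/
def sliceRight (φ : N →ₗ[R] R) : M ⊗[R] N →ₗ[R] M :=
  (TensorProduct.rid R M).toLinearMap ∘ₗ φ.lTensor M

@[simp]
theorem sliceRight_tmul (φ : N →ₗ[R] R) (x : M) (y : N) : sliceRight φ (x ⊗ₜ y) = φ y • x := by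
  simp [sliceRight]

theorem sliceRight_map (φ : N' →ₗ[R] R) (f : M →ₗ[R] M') (g : N →ₗ[R] N') (z : M ⊗[R] N) :
    sliceRight φ (TensorProduct.map f g z) = f (sliceRight (φ ∘ₗ g) z) := by
  suffices sliceRight φ ∘ₗ TensorProduct.map f g = f ∘ₗ sliceRight (φ ∘ₗ g) from
    DFunLike.congr_fun this z
  exact TensorProduct.ext' fun x y => by simp

theorem eq_zero_of_forall_sliceRight_eq_zero [Module.Free R N] {z : M ⊗[R] N}
    (h : ∀ φ : N →ₗ[R] R, sliceRight φ z = 0) : z = 0 := by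
  classical
  let b := Module.Free.chooseBasis R N
  have coord (z : M ⊗[R] N) (i) :
      TensorProduct.equivFinsuppOfBasisRight b z i = sliceRight (b.coord i) z := by
    induction z using TensorProduct.induction_on with
    | zero => simp
    | add x y hx hy => rw [map_add, map_add, Finsupp.add_apply, hx, hy]
    | tmul x y => simp
  refine (TensorProduct.equivFinsuppOfBasisRight b).injective (Finsupp.ext fun i => ?_)
  rw [coord, h, map_zero, Finsupp.zero_apply]

end Slice

namespace UqPlus

variable {F : Type u} [Field F] {q : F}

/-! ### Word length and the braided coproduct -/

section Length

/-- The combinations of words of length less than `n` in the generators. -/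
def lengthLT (F : Type u) [Field F] (q : F) : ℕ → Submodule F (UqPlus F q)
  | 0 => ⊥
  | n + 1 => Submodule.span F {1} ⊔ ⨆ i, (lengthLT F q n).map (LinearMap.mulLeft F (gen F q i))

theorem lengthLT_succ_le {n : ℕ} {P : Submodule F (UqPlus F q)} :
    lengthLT F q (n + 1) ≤ P ↔ 1 ∈ P ∧ ∀ i, ∀ a ∈ lengthLT F q n, gen F q i * a ∈ P := by
  rw [lengthLT, sup_le_iff, Submodule.span_singleton_le_iff_mem, iSup_le_iff]
  simp only [Submodule.map_le_iff_le_comap]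
  rfl

theorem one_mem_lengthLT (n : ℕ) : (1 : UqPlus F q) ∈ lengthLT F q (n + 1) :=
  (lengthLT_succ_le.1 le_rfl).1

theorem gen_mul_mem_lengthLT {n : ℕ} (i : Bool) {a : UqPlus F q} (ha : a ∈ lengthLT F q n) :
    gen F q i * a ∈ lengthLT F q (n + 1) :=
  (lengthLT_succ_le.1 le_rfl).2 i a ha

theorem lengthLT_mono : Monotone (lengthLT F q) := by
  refine monotone_nat_of_le_succ fun n => ?_
  induction n with
  | zero => exact bot_le
  | succ n ih =>
    exact lengthLT_succ_le.2
      ⟨one_mem_lengthLT _, fun i a ha => gen_mul_mem_lengthLT i (ih ha)⟩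

theorem exists_mem_lengthLT (w : UqPlus F q) : ∃ n, w ∈ lengthLT F q n := by
  induction w using induction_left with
  | one => exact ⟨1, one_mem_lengthLT 0⟩
  | add a b ha hb =>
    obtain ⟨m, hm⟩ := ha
    obtain ⟨n, hn⟩ := hb
    exact ⟨max m n, add_mem (lengthLT_mono (le_max_left m n) hm)
      (lengthLT_mono (le_max_right m n) hn)⟩
  | smul c a ha => obtain ⟨m, hm⟩ := ha; exact ⟨m, Submodule.smul_mem _ c hm⟩
  | gen_mul i a ha => obtain ⟨m, hm⟩ := ha; exact ⟨m + 1, gen_mul_mem_lengthLT i hm⟩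

theorem twist_mem_lengthLT (k : Bool) {n : ℕ} {a : UqPlus F q} (ha : a ∈ lengthLT F q n) :
    twist k a ∈ lengthLT F q n := by
  suffices lengthLT F q n ≤ (lengthLT F q n).comap (twist k).toLinearMap from this ha
  clear ha
  induction n with
  | zero => exact bot_le
  | succ n ih =>
    refine lengthLT_succ_le.2 ⟨?_, fun i a ha => ?_⟩ <;>
      rw [Submodule.mem_comap, AlgHom.toLinearMap_apply]
    · rw [map_one]
      exact one_mem_lengthLT n
    · rw [map_mul, twist_gen, smul_mul_assoc]
      exact Submodule.smul_mem _ _ (gen_mul_mem_lengthLT i (ih ha))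

theorem skewDer_mem_lengthLT [IsGeneric q] (k : Bool) (c : Bool → F) {n : ℕ} {a : UqPlus F q}
    (ha : a ∈ lengthLT F q (n + 1)) : skewDer k c a ∈ lengthLT F q n := by
  suffices lengthLT F q (n + 1) ≤ (lengthLT F q n).comap (skewDer k c) from this ha
  clear ha
  induction n with
  | zero =>
    refine lengthLT_succ_le.2 ⟨by simp, fun i a ha => ?_⟩
    rw [(Submodule.mem_bot F).1 ha, mul_zero]
    exact zero_mem _
  | succ n ih =>
    refine lengthLT_succ_le.2 ⟨by simp, fun i a ha => ?_⟩
    rw [Submodule.mem_comap, skewDer_gen_mul]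
    exact add_mem (Submodule.smul_mem _ _ ha)
      (Submodule.smul_mem _ _ (gen_mul_mem_lengthLT i (ih ha)))

end Length

theorem counit_twist (k : Bool) (w : UqPlus F q) : counit (twist k w) = counit w := by
  suffices counit.comp (twist k) = counit (F := F) (q := q) from DFunLike.congr_fun this w
  exact algHom_ext fun i => by simp

theorem twist_mul_mulLeft_gen (k j : Bool) :
    ((twist k).toLinearMap : Module.End F (UqPlus F q)) * LinearMap.mulLeft F (gen F q j) =
      rootTwist q k j • (LinearMap.mulLeft F (gen F q j) * (twist k).toLinearMap) := by
  ext w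
  simp

theorem qSerre_mulLeft_gen (i : Bool) :
    qSerre q (LinearMap.mulLeft F (gen F q i)) (LinearMap.mulLeft F (gen F q (!i))) = 0 := by
  have h := map_qSerre (q := q) (Algebra.lmul F (UqPlus F q)) (gen F q i) (gen F q (!i))
  rw [qSerre_gen, map_zero] at h
  exact h.symm

section Coproduct

variable [IsGeneric q]

/-- The algebra map `w ↦ (x ↦ Δ w · (x ⊗ 1))`, where `Δ` is the braided coproduct. Endomorphisms in
the first factor make the ordinary tensor product of algebras suffice. -/
def coproductAlgHom : UqPlus F q →ₐ[F] Module.End F (UqPlus F q) ⊗[F] UqPlus F q :=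
  lift (R := Module.End F (UqPlus F q) ⊗[F] UqPlus F q)
    (fun i => LinearMap.mulLeft F (gen F q i) ⊗ₜ 1 + (twist i).toLinearMap ⊗ₜ gen F q i)
    fun i => by
      have hcomm : Commute ((twist i).toLinearMap : Module.End F (UqPlus F q))
          (twist (!i)).toLinearMap := LinearMap.ext (twist_comm i (!i))
      have hq : qInt q 3 = q ^ 2 + 1 + (q ^ 2)⁻¹ := IsGeneric.qInt_three
      rw [qSerre_add IsGeneric.sq_ne_zero hq, qSerre_tmul_one, qSerre_mulLeft_gen,
        qSerre_tmul_of_commute hcomm, qSerre_gen, TensorProduct.zero_tmul,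
        TensorProduct.tmul_zero, add_zero]
      all_goals
        simp only [Algebra.TensorProduct.tmul_mul_tmul, twist_mul_mulLeft_gen, rootTwist_self,
          rootTwist_not_left, rootTwist_not_right, TensorProduct.smul_tmul', mul_one, one_mul]

/-- The braided coproduct of `UqPlus F q`. -/
def coproduct : UqPlus F q →ₗ[F] UqPlus F q ⊗[F] UqPlus F q :=
  (LinearMap.applyₗ (1 : UqPlus F q)).rTensor (UqPlus F q) ∘ₗ coproductAlgHom.toLinearMap

theorem coproduct_one : coproduct (1 : UqPlus F q) = 1 ⊗ₜ 1 := by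
  simp [coproduct, Algebra.TensorProduct.one_def]

theorem coproduct_gen_mul (i : Bool) (w : UqPlus F q) :
    coproduct (gen F q i * w) =
      TensorProduct.map (LinearMap.mulLeft F (gen F q i)) LinearMap.id (coproduct w) +
      TensorProduct.map (twist i).toLinearMap (LinearMap.mulLeft F (gen F q i)) (coproduct w) := by
  have tmul_mul (f : Module.End F (UqPlus F q)) (a : UqPlus F q)
      (z : Module.End F (UqPlus F q) ⊗[F] UqPlus F q) :
      (LinearMap.applyₗ (1 : UqPlus F q)).rTensor (UqPlus F q) (f ⊗ₜ[F] a * z) =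
        TensorProduct.map f (LinearMap.mulLeft F a)
          ((LinearMap.applyₗ (1 : UqPlus F q)).rTensor (UqPlus F q) z) := by
    induction z using TensorProduct.induction_on with
    | zero => simp
    | add x y hx hy => simp only [mul_add, map_add, hx, hy]
    | tmul x y => simp [Algebra.TensorProduct.tmul_mul_tmul]
  rw [coproduct, LinearMap.comp_apply, AlgHom.toLinearMap_apply, map_mul]
  nth_rw 1 [coproductAlgHom]
  rw [lift_gen, add_mul, map_add, tmul_mul, tmul_mul, LinearMap.mulLeft_one]
  rfl

theorem rTensor_derL_coproduct (k : Bool) (w : UqPlus F q) :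
    (derL k).rTensor (UqPlus F q) (coproduct w) = coproduct (derL k w) := by
  suffices (derL k).rTensor (UqPlus F q) ∘ₗ coproduct = coproduct (F := F) ∘ₗ derL k from
    DFunLike.congr_fun this w
  refine linearMap_ext (by simp [coproduct_one]) fun i a ha => ?_
  rw [LinearMap.comp_apply, LinearMap.comp_apply] at ha ⊢
  rw [derL_gen_mul, map_add coproduct, map_smul, map_smul, coproduct_gen_mul, coproduct_gen_mul,
    ← ha]
  induction coproduct a using TensorProduct.induction_on with
  | zero => simp
  | add x y hx hy =>
    simp only [map_add, smul_add] at hx hy ⊢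
    rw [add_add_add_comm, hx, hy]
    abel
  | tmul x y =>
    simp only [TensorProduct.map_tmul, map_add, LinearMap.rTensor_tmul, LinearMap.mulLeft_apply,
      LinearMap.id_apply, AlgHom.toLinearMap_apply, derL_gen_mul, derL_twist, rootTwist_comm i k,
      TensorProduct.add_tmul, TensorProduct.smul_tmul', smul_add, add_assoc]

theorem counit_sliceRight_coproduct (φ : UqPlus F q →ₗ[F] F) (w : UqPlus F q) :
    counit (sliceRight φ (coproduct w)) = φ w := by
  induction w using induction_left generalizing φ with
  | one => simp [coproduct_one]
  | add a b ha hb => simp only [map_add, ha, hb]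
  | smul c a ha => simp only [map_smul, ha]
  | gen_mul i a ha =>
    rw [coproduct_gen_mul, map_add, sliceRight_map, sliceRight_map, LinearMap.mulLeft_apply,
      AlgHom.toLinearMap_apply, map_add, map_mul, counit_gen, zero_mul, zero_add, counit_twist, ha]
    rfl

theorem sliceRight_coproduct_sub_mem_lengthLT {n : ℕ} {w : UqPlus F q}
    (hw : w ∈ lengthLT F q (n + 1)) (φ : UqPlus F q →ₗ[F] F) :
    sliceRight φ (coproduct w) - φ 1 • w ∈ lengthLT F q n := by
  suffices lengthLT F q (n + 1) ≤
      (lengthLT F q n).comap (sliceRight φ ∘ₗ coproduct - φ 1 • LinearMap.id) from this hw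
  clear hw
  induction n generalizing φ with
  | zero =>
    refine lengthLT_succ_le.2 ⟨by simp [coproduct_one], fun i a ha => ?_⟩
    rw [(Submodule.mem_bot F).1 ha, mul_zero]
    exact zero_mem _
  | succ n ih =>
    refine lengthLT_succ_le.2 ⟨by simp [coproduct_one], fun i a ha => ?_⟩
    have slice_gen_mul : sliceRight φ (coproduct (gen F q i * a)) - φ 1 • (gen F q i * a) =
        gen F q i * (sliceRight φ (coproduct a) - φ 1 • a) +
          twist i (sliceRight (φ ∘ₗ LinearMap.mulLeft F (gen F q i)) (coproduct a)) := by
      rw [coproduct_gen_mul, map_add, sliceRight_map, sliceRight_map, mul_sub, mul_smul_comm,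
        add_sub_right_comm]
      rfl
    change sliceRight φ (coproduct (gen F q i * a)) - φ 1 • (gen F q i * a) ∈ lengthLT F q (n + 1)
    rw [slice_gen_mul]
    refine add_mem (gen_mul_mem_lengthLT i (ih φ ha)) (twist_mem_lengthLT i ?_)
    rw [← sub_add_cancel (sliceRight _ (coproduct a)) _]
    exact add_mem (lengthLT_mono n.le_succ (ih _ ha)) (Submodule.smul_mem _ _ ha)

theorem coproduct_eq_of_derL_eq_zero {n : ℕ}
    (ih : ∀ w ∈ lengthLT F q n, (∀ k, derL k w = 0) → w = counit w • 1)
    {v : UqPlus F q} (hn : v ∈ lengthLT F q (n + 1)) (hv : ∀ k, derL k v = 0)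
    (h0 : counit v = 0) : coproduct v = v ⊗ₜ 1 + 1 ⊗ₜ v := by
  refine sub_eq_zero.1 (eq_zero_of_forall_sliceRight_eq_zero fun φ => ?_)
  have hslice := ih _ (sliceRight_coproduct_sub_mem_lengthLT hn φ) fun k => by
    have h : derL k (sliceRight φ (coproduct v)) =
        sliceRight φ ((derL k).rTensor (UqPlus F q) (coproduct v)) :=
      (sliceRight_map φ (derL k) LinearMap.id _).symm
    rw [map_sub, map_smul, h, rTensor_derL_coproduct, hv, map_zero, map_zero, smul_zero, sub_zero]
  rw [map_sub, map_smul, counit_sliceRight_coproduct, h0, smul_zero, sub_zero] at hslice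
  rw [map_sub, map_add, sliceRight_tmul, sliceRight_tmul, ← hslice]
  abel

end Coproduct

section Antipode

theorem neg_mulRight_gen_mul_twist_apply (i : Bool) (w : UqPlus F q) :
    (-(LinearMap.mulRight F (gen F q i) * (twist i).toLinearMap) : Module.End F (UqPlus F q)) w =
      -(twist i w * gen F q i) := rfl

variable [IsGeneric q]

/-- The algebra map whose orbit map at `1` is the braided antipode. -/
def antipodeAlgHom : UqPlus F q →ₐ[F] Module.End F (UqPlus F q) :=
  lift (fun i => -(LinearMap.mulRight F (gen F q i) * (twist i).toLinearMap)) fun i => by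
    ext w
    have h0 : q ≠ 0 := IsGeneric.ne_zero
    trans -(twist i (twist i (twist i (twist (!i) w))) * qSerre q (gen F q i) (gen F q (!i)))
    · simp only [qSerre, pow_succ, pow_zero, one_mul, LinearMap.sub_apply, LinearMap.add_apply,
        LinearMap.smul_apply, Module.End.mul_apply, neg_mulRight_gen_mul_twist_apply, map_neg,
        map_mul, twist_gen, map_smul, twist_comm (!i) i, rootTwist_self, rootTwist_not_left,
        rootTwist_not_right, neg_neg, smul_mul_assoc, mul_smul_comm, smul_smul, mul_assoc, mul_add,
        mul_sub]
      match_scalars <;> field_simp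
    · rw [qSerre_gen, mul_zero, neg_zero]
      rfl

/-- The braided antipode of `UqPlus F q`. -/
def antipode : UqPlus F q →ₗ[F] UqPlus F q :=
  LinearMap.applyₗ (1 : UqPlus F q) ∘ₗ antipodeAlgHom.toLinearMap

@[simp]
theorem antipode_one : antipode (1 : UqPlus F q) = 1 := by simp [antipode]

theorem antipode_gen_mul (i : Bool) (w : UqPlus F q) :
    antipode (gen F q i * w) = -(twist i (antipode w) * gen F q i) := by
  simp [antipode, antipodeAlgHom]

theorem antipode_twist (k : Bool) (w : UqPlus F q) :
    antipode (twist k w) = twist k (antipode w) := by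
  induction w using induction_left with
  | one => simp
  | add a b ha hb => simp only [map_add, ha, hb]
  | smul c a ha => simp only [map_smul, ha]
  | gen_mul i a ha =>
    rw [map_mul, twist_gen, smul_mul_assoc, map_smul, antipode_gen_mul, antipode_gen_mul, ha,
      map_neg, map_mul, twist_gen, twist_comm, mul_smul_comm, smul_neg]

theorem antipode_mul_gen (i : Bool) (w : UqPlus F q) :
    antipode (w * gen F q i) = -(gen F q i * twist i (antipode w)) := by
  induction w using induction_left with
  | one => simpa using antipode_gen_mul (F := F) (q := q) i 1
  | add a b ha hb => simp only [add_mul, map_add, ha, hb, mul_add, neg_add]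
  | smul c a ha => simp only [smul_mul_assoc, map_smul, ha, mul_smul_comm, smul_neg]
  | gen_mul j a ha =>
    rw [mul_assoc, antipode_gen_mul, ha, antipode_gen_mul]
    simp only [map_neg, map_mul, twist_gen, smul_mul_assoc, mul_smul_comm, neg_mul, mul_neg,
      mul_assoc, rootTwist_comm i j, twist_comm i j]

theorem antipode_antipode_gen_mul (i : Bool) (w : UqPlus F q) :
    antipode (antipode (gen F q i * w)) =
      gen F q i * twist i (twist i (antipode (antipode w))) := by
  rw [antipode_gen_mul, map_neg, antipode_mul_gen, antipode_twist, neg_neg]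

theorem mul_antipode_coproduct (w : UqPlus F q) :
    LinearMap.mul' F (UqPlus F q) (antipode.lTensor (UqPlus F q) (coproduct w)) =
      counit w • 1 := by
  induction w using induction_left with
  | one => simp [coproduct_one]
  | add a b ha hb => simp only [map_add, ha, hb, add_smul]
  | smul c a ha => simp only [map_smul, ha, smul_eq_mul, mul_smul]
  | gen_mul i a ha =>
    have mul_antipode_map (z : UqPlus F q ⊗[F] UqPlus F q) :
        LinearMap.mul' F (UqPlus F q) (antipode.lTensor (UqPlus F q)
          (TensorProduct.map (LinearMap.mulLeft F (gen F q i)) LinearMap.id z +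
            TensorProduct.map (twist i).toLinearMap (LinearMap.mulLeft F (gen F q i)) z)) =
        gen F q i * LinearMap.mul' F (UqPlus F q) (antipode.lTensor (UqPlus F q) z) -
          twist i (LinearMap.mul' F (UqPlus F q) (antipode.lTensor (UqPlus F q) z)) *
            gen F q i := by
      induction z using TensorProduct.induction_on with
      | zero => simp
      | add x y hx hy =>
        simp only [map_add, mul_add, add_mul] at hx hy ⊢
        rw [add_add_add_comm, hx, hy]
        abel
      | tmul x y => simp [antipode_gen_mul, mul_assoc, sub_eq_add_neg]
    rw [coproduct_gen_mul, mul_antipode_map, ha, map_smul, map_one, mul_smul_comm, mul_one,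
      smul_mul_assoc, one_mul, sub_self, map_mul, counit_gen, zero_mul, zero_smul]

theorem antipode_eq_neg_of_primitive {v : UqPlus F q} (hv : coproduct v = v ⊗ₜ 1 + 1 ⊗ₜ v)
    (h0 : counit v = 0) : antipode v = -v := by
  have h := mul_antipode_coproduct v
  rw [hv, h0] at h
  simp only [map_add, LinearMap.lTensor_tmul, LinearMap.mul'_apply, antipode_one, mul_one,
    one_mul, zero_smul] at h
  exact eq_neg_of_add_eq_zero_right h

end Antipode

/-! ### The multigrading -/

section Grading

/-- The simple root attached to a generator. -/
abbrev simpleRoot (i : Bool) : Bool → ℤ := Pi.single i 1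

/-- The coaction recording the degree in each of the two generators. -/
noncomputable def degreeAlgHom : UqPlus F q →ₐ[F] AddMonoidAlgebra (UqPlus F q) (Bool → ℤ) :=
  lift (fun i => AddMonoidAlgebra.single (simpleRoot i) (gen F q i)) fun i => by
    rw [qSerre_single, qSerre_gen, AddMonoidAlgebra.single_zero]

/-- The projection to the homogeneous component of degree `γ`. -/
noncomputable def proj (γ : Bool → ℤ) : UqPlus F q →ₗ[F] UqPlus F q where
  toFun w := (degreeAlgHom w).coeff γ
  map_add' a b := by simp
  map_smul' a b := by simp

theorem proj_gen_mul (γ : Bool → ℤ) (i : Bool) (w : UqPlus F q) :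
    proj γ (gen F q i * w) = gen F q i * proj (γ - simpleRoot i) w := by
  change (degreeAlgHom _).coeff γ = _
  rw [map_mul, degreeAlgHom, lift_gen, AddMonoidAlgebra.coeff_single_mul_apply, neg_add_eq_sub]
  rfl

theorem proj_mul_gen (γ : Bool → ℤ) (i : Bool) (w : UqPlus F q) :
    proj γ (w * gen F q i) = proj (γ - simpleRoot i) w * gen F q i := by
  change (degreeAlgHom _).coeff γ = _
  rw [map_mul, degreeAlgHom, lift_gen, AddMonoidAlgebra.coeff_mul_single_apply, ← sub_eq_add_neg]
  rfl

theorem proj_one (γ : Bool → ℤ) : proj γ (1 : UqPlus F q) = if γ = 0 then 1 else 0 := by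
  change (degreeAlgHom _).coeff γ = _
  rw [map_one, AddMonoidAlgebra.one_def, AddMonoidAlgebra.coeff_single, Finsupp.single_apply]
  simp only [eq_comm]

theorem proj_proj (γ : Bool → ℤ) (w : UqPlus F q) : proj γ (proj γ w) = proj γ w := by
  induction w using induction_left generalizing γ with
  | one => rw [proj_one]; split_ifs with h <;> simp [proj_one, h]
  | add a b ha hb => simp only [map_add, ha, hb]
  | smul c a ha => simp only [map_smul, ha]
  | gen_mul i a ha => rw [proj_gen_mul, proj_gen_mul, ha]

theorem proj_eq_zero_of_neg {γ : Bool → ℤ} (j : Bool) (hγ : γ j < 0) (w : UqPlus F q) :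
    proj γ w = 0 := by
  induction w using induction_left generalizing γ with
  | one => rw [proj_one, if_neg]; rintro rfl; exact lt_irrefl _ hγ
  | add a b ha hb => rw [map_add, ha hγ, hb hγ, add_zero]
  | smul c a ha => rw [map_smul, ha hγ, smul_zero]
  | gen_mul i a ha =>
    have hroot : 0 ≤ simpleRoot i := Pi.single_nonneg.2 zero_le_one
    rw [proj_gen_mul, ha ((sub_le_self (γ j) (hroot j)).trans_lt hγ), mul_zero]

theorem proj_zero (w : UqPlus F q) : proj 0 w = counit w • 1 := by
  induction w using induction_left with
  | one => simp [proj_one]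
  | add a b ha hb => simp only [map_add, ha, hb, add_smul]
  | smul c a ha => simp only [map_smul, ha, smul_eq_mul, mul_smul]
  | gen_mul i a _ => rw [proj_gen_mul, proj_eq_zero_of_neg i (by simp)]; simp

/-- The counit of the coaction `degreeAlgHom`. -/
noncomputable def forgetDegree : AddMonoidAlgebra (UqPlus F q) (Bool → ℤ) →ₐ[F] UqPlus F q :=
  AddMonoidAlgebra.liftNCAlgHom (AlgHom.id F _) 1 fun _ _ => Commute.one_right _

theorem forgetDegree_single (γ : Bool → ℤ) (a : UqPlus F q) :
    forgetDegree (AddMonoidAlgebra.single γ a) = a :=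
  (AddMonoidAlgebra.liftNC_single _ _ _ _).trans (mul_one a)

theorem forgetDegree_degreeAlgHom (w : UqPlus F q) : forgetDegree (degreeAlgHom w) = w := by
  suffices forgetDegree.comp degreeAlgHom = AlgHom.id F (UqPlus F q) from DFunLike.congr_fun this w
  exact algHom_ext fun i => by
    rw [AlgHom.comp_apply, degreeAlgHom, lift_gen, forgetDegree_single, AlgHom.id_apply]

theorem eq_counit_of_proj_eq_zero {w : UqPlus F q} (h : ∀ γ, γ ≠ 0 → proj γ w = 0) :
    w = counit w • 1 := by
  have hdeg : degreeAlgHom w = AddMonoidAlgebra.single 0 (proj 0 w) := by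
    ext γ
    rw [AddMonoidAlgebra.coeff_single, Finsupp.single_apply]
    split_ifs with h0
    · rw [← h0]; rfl
    · exact h γ (Ne.symm h0)
  rw [← proj_zero, ← forgetDegree_single 0 (proj 0 w), ← hdeg, forgetDegree_degreeAlgHom]

theorem proj_twist (γ : Bool → ℤ) (k : Bool) (w : UqPlus F q) :
    proj γ (twist k w) = twist k (proj γ w) := by
  induction w using induction_left generalizing γ with
  | one => rw [map_one, proj_one]; split_ifs <;> simp
  | add a b ha hb => simp only [map_add, ha, hb]
  | smul c a ha => simp only [map_smul, ha]
  | gen_mul i a ha =>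
    rw [map_mul, twist_gen, smul_mul_assoc, map_smul, proj_gen_mul, ha, proj_gen_mul, map_mul,
      twist_gen, smul_mul_assoc]

theorem rootTwist_eq_zpow (k i : Bool) :
    rootTwist q k i = (q ^ 2) ^ (simpleRoot i k - simpleRoot i (!k)) := by
  cases k <;> cases i <;> simp [rootTwist]

variable [IsGeneric q]

theorem twist_proj (k : Bool) (γ : Bool → ℤ) (w : UqPlus F q) :
    twist k (proj γ w) = (q ^ 2) ^ (γ k - γ (!k)) • proj γ w := by
  induction w using induction_left generalizing γ with
  | one => rw [proj_one]; split_ifs with h <;> simp [h]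
  | add a b ha hb => simp only [map_add, ha, hb, smul_add]
  | smul c a ha => simp only [map_smul, ha, smul_comm c]
  | gen_mul i a ha =>
    rw [proj_gen_mul, map_mul, ha, twist_gen, smul_mul_assoc, mul_smul_comm, smul_smul,
      rootTwist_eq_zpow, ← zpow_add₀ IsGeneric.sq_ne_zero]
    congr 2
    simp only [Pi.sub_apply]
    ring

theorem proj_antipode (γ : Bool → ℤ) (w : UqPlus F q) :
    proj γ (antipode w) = antipode (proj γ w) := by
  induction w using induction_left generalizing γ with
  | one => rw [antipode_one, proj_one]; split_ifs <;> simp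
  | add a b ha hb => simp only [map_add, ha, hb]
  | smul c a ha => simp only [map_smul, ha]
  | gen_mul i a ha =>
    rw [antipode_gen_mul, map_neg, proj_mul_gen, proj_twist, ha, proj_gen_mul, antipode_gen_mul]

theorem antipode_antipode_proj (γ : Bool → ℤ) (w : UqPlus F q) :
    antipode (antipode (proj γ w)) =
      (q ^ 2) ^ ((γ false - γ true) ^ 2 - (γ false + γ true)) • proj γ w := by
  induction w using induction_left generalizing γ with
  | one => rw [proj_one]; split_ifs with h <;> simp [h]
  | add a b ha hb => simp only [map_add, ha, hb, smul_add]
  | smul c a ha => simp only [map_smul, ha, smul_comm c]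
  | gen_mul i a ha =>
    rw [proj_gen_mul, antipode_antipode_gen_mul, ha, map_smul, map_smul, twist_proj, map_smul,
      twist_proj, smul_smul, smul_smul, mul_smul_comm, ← zpow_add₀ IsGeneric.sq_ne_zero,
      ← zpow_add₀ IsGeneric.sq_ne_zero]
    congr 2
    cases i <;> simp <;> ring

theorem skewDer_single_proj (k j : Bool) (γ : Bool → ℤ) (w : UqPlus F q) :
    skewDer k (Pi.single j 1) (proj γ w) =
      proj (γ - simpleRoot j) (skewDer k (Pi.single j 1) w) := by
  induction w using induction_left generalizing γ with
  | one => rw [proj_one]; split_ifs <;> simp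
  | add a b ha hb => simp only [map_add, ha, hb]
  | smul c a ha => simp only [map_smul, ha]
  | gen_mul i a ha =>
    rw [proj_gen_mul, skewDer_gen_mul, ha, skewDer_gen_mul, map_add, map_smul, map_smul,
      proj_gen_mul, sub_right_comm]
    obtain rfl | h := eq_or_ne i j
    · rfl
    · rw [Pi.single_eq_of_ne h, zero_smul, zero_smul]

theorem derL_proj (k : Bool) (γ : Bool → ℤ) (w : UqPlus F q) :
    derL k (proj γ w) = proj (γ - simpleRoot k) (derL k w) :=
  skewDer_single_proj _ _ _ _

theorem derR_proj (k : Bool) (γ : Bool → ℤ) (w : UqPlus F q) :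
    derR k (proj γ w) = proj (γ - simpleRoot k) (derR k w) :=
  skewDer_single_proj _ _ _ _

end Grading

/-! ### The `U_q(sl₂)`-action attached to a generator -/

section QCommutator

/-- The `q`-commutator `w ↦ e_k w - K_k⁻¹ w e_k` with the generator `e_k`; the twist `K_k⁻¹` is
`twist (!k)`. -/
def qCommutator (k : Bool) : Module.End F (UqPlus F q) :=
  LinearMap.mulLeft F (gen F q k) - LinearMap.mulRight F (gen F q k) * (twist (!k)).toLinearMap

theorem qCommutator_apply (k : Bool) (w : UqPlus F q) :
    qCommutator k w = gen F q k * w - twist (!k) w * gen F q k := rfl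

theorem qCommutator_pow_succ_apply (k : Bool) (i : ℕ) (w : UqPlus F q) :
    (qCommutator k ^ (i + 1)) w = qCommutator k ((qCommutator k ^ i) w) := by
  rw [pow_succ', Module.End.mul_apply]

theorem twist_qCommutator_pow {k : Bool} {v : UqPlus F q} {r : F} (hv : twist (!k) v = r • v)
    (i : ℕ) :
    twist (!k) ((qCommutator k ^ i) v) = (r * (q ^ 2)⁻¹ ^ i) • (qCommutator k ^ i) v := by
  induction i with
  | zero => simpa using hv
  | succ i ih =>
    rw [qCommutator_pow_succ_apply, qCommutator_apply, map_sub, map_mul, map_mul, ih, map_smul, ih,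
      twist_gen, rootTwist_not_left, rootTwist_self, pow_succ]
    simp only [smul_mul_assoc, mul_smul_comm, smul_smul, smul_sub]
    ring_nf

theorem proj_qCommutator_pow {k : Bool} {v : UqPlus F q} {γ : Bool → ℤ} (hv : proj γ v = v)
    (i : ℕ) : proj (γ + i • simpleRoot k) ((qCommutator k ^ i) v) = (qCommutator k ^ i) v := by
  induction i with
  | zero => simpa using hv
  | succ i ih =>
    rw [qCommutator_pow_succ_apply, qCommutator_apply, map_sub, proj_gen_mul, proj_mul_gen,
      proj_twist, succ_nsmul, ← add_assoc, add_sub_cancel_right, ih]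

variable [IsGeneric q]

theorem derL_qCommutator (k : Bool) (w : UqPlus F q) :
    derL k (qCommutator k w) =
      q ^ 2 • (gen F q k * derL k w) - (q ^ 2)⁻¹ • (twist (!k) (derL k w) * gen F q k) := by
  rw [qCommutator_apply, map_sub, derL_mul, derL_mul, derL_twist, twist_twist_not, derL_gen_self,
    twist_gen, rootTwist_not_left, rootTwist_self, one_mul, mul_one, smul_mul_assoc,
    smul_mul_assoc, add_comm, add_sub_add_right_eq_sub]

theorem derL_qCommutator_pow_eq_zero {k : Bool} {v : UqPlus F q} (hv : derL k v = 0) (i : ℕ) :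
    derL k ((qCommutator k ^ i) v) = 0 := by
  induction i with
  | zero => exact hv
  | succ i ih =>
    rw [qCommutator_pow_succ_apply, derL_qCommutator, ih]
    simp only [mul_zero, map_zero, zero_mul, smul_zero, sub_zero]

theorem derR_qCommutator (k : Bool) (w : UqPlus F q) :
    derR k (qCommutator k w) =
      w - twist (!k) (twist (!k) w) + (q ^ 2)⁻¹ • qCommutator k (derR k w) := by
  rw [qCommutator_apply, qCommutator_apply, map_sub, derR_mul, derR_mul, derR_twist,
    derR_gen_self, twist_gen, rootTwist_not_left, rootTwist_self, one_mul, mul_one]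
  simp only [smul_mul_assoc, smul_sub]
  abel

/-- The scalar is `∑ j ∈ range (i + 1), t^(j-i) (1 - r² t^(-2j))` with `t = q²`, summed in closed
form. -/
theorem derR_qCommutator_pow_succ {k : Bool} {v : UqPlus F q} {r : F}
    (hv : twist (!k) v = r • v) (h0 : derR k v = 0) (i : ℕ) :
    derR k ((qCommutator k ^ (i + 1)) v) =
      (((q ^ 2) ^ (i + 1) - 1) * ((q ^ 2) ^ i - r ^ 2) / ((q ^ 2 - 1) * (q ^ 2) ^ (2 * i))) •
        (qCommutator k ^ i) v := by
  have ht : q ^ 2 ≠ 0 := IsGeneric.sq_ne_zero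
  have ht1 : q ^ 2 - 1 ≠ 0 := sub_ne_zero.2 IsGeneric.sq_ne_one
  induction i with
  | zero =>
    rw [zero_add, pow_one, derR_qCommutator, h0, map_zero, hv, map_smul, hv,
      pow_zero (qCommutator k), Module.End.one_apply]
    match_scalars
    field_simp
    ring
  | succ i ih =>
    rw [qCommutator_pow_succ_apply, derR_qCommutator, ih, map_smul,
      ← qCommutator_pow_succ_apply, twist_qCommutator_pow hv, map_smul, twist_qCommutator_pow hv,
      inv_pow]
    generalize q ^ 2 = t at ht ht1
    match_scalars
    field_simp
    ring

end QCommutator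

section RootSpan

/-- The iterated `q`-commutators of the generator `k` with the other one. -/
def rootVector (F : Type u) [Field F] (q : F) (k : Bool) (j : ℕ) : UqPlus F q :=
  (qCommutator k ^ j) (gen F q (!k))

theorem rootVector_succ (k : Bool) (j : ℕ) :
    rootVector F q k (j + 1) = gen F q k * rootVector F q k j -
      (q ^ 2 * (q ^ 2)⁻¹ ^ j) • (rootVector F q k j * gen F q k) := by
  have htwist : twist (!k) (gen F q (!k)) = q ^ 2 • gen F q (!k) := by
    rw [twist_gen, rootTwist_self]
  rw [rootVector, rootVector, qCommutator_pow_succ_apply, qCommutator_apply,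
    twist_qCommutator_pow htwist, smul_mul_assoc]

/-- Products of a power of the generator `k` and of root vectors, of degree `m` in the generator `k`
and of degree `n` in the other one. -/
inductive IsRootMonomial (k : Bool) : ℤ → ℤ → UqPlus F q → Prop
  | pow (a : ℕ) : IsRootMonomial k a 0 (gen F q k ^ a)
  | mul_rootVector {m n : ℤ} {a : UqPlus F q} {j : ℕ} (hj : j ≤ 2) :
      IsRootMonomial k m n a → IsRootMonomial k (m + j) (n + 1) (a * rootVector F q k j)

/-- The span of the root monomials of degrees `m` and `n`. -/
def rootSpan (F : Type u) [Field F] (q : F) (k : Bool) (m n : ℤ) : Submodule F (UqPlus F q) :=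
  Submodule.span F {a | IsRootMonomial k m n a}

variable [IsGeneric q]

theorem rootVector_mul_gen (k : Bool) (j : ℕ) :
    rootVector F q k j * gen F q k =
      ((q ^ 2)⁻¹ * (q ^ 2) ^ j) • (gen F q k * rootVector F q k j - rootVector F q k (j + 1)) := by
  have ht : q ^ 2 ≠ 0 := IsGeneric.sq_ne_zero
  have hscalar : (q ^ 2)⁻¹ * (q ^ 2) ^ j * (q ^ 2 * (q ^ 2)⁻¹ ^ j) = 1 := by
    generalize q ^ 2 = t at ht
    rw [inv_pow]
    field_simp
  rw [rootVector_succ, sub_sub_cancel, smul_smul, hscalar, one_smul]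

theorem rootVector_three (k : Bool) : rootVector F q k 3 = 0 := by
  have h0 : q ≠ 0 := IsGeneric.ne_zero
  have hzero : rootVector F q k 0 = gen F q (!k) := rfl
  trans qSerre q (gen F q k) (gen F q (!k))
  · rw [rootVector_succ, rootVector_succ, rootVector_succ, hzero, qSerre, IsGeneric.qInt_three]
    simp only [mul_sub, sub_mul, smul_sub, smul_mul_assoc, mul_smul_comm, mul_assoc, pow_succ,
      pow_zero, one_mul]
    match_scalars <;> field_simp <;> ring
  · exact qSerre_gen k

theorem rootVector_eq_zero (k : Bool) {j : ℕ} (hj : 2 < j) : rootVector F q k j = 0 := by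
  obtain ⟨i, rfl⟩ := Nat.exists_eq_add_of_le' hj
  rw [rootVector, pow_add, Module.End.mul_apply]
  exact (congrArg _ (rootVector_three k)).trans (map_zero _)

theorem mul_rootVector_mem_rootSpan {k : Bool} {m n : ℤ} {a : UqPlus F q}
    (ha : a ∈ rootSpan F q k m n) (j : ℕ) :
    a * rootVector F q k j ∈ rootSpan F q k (m + j) (n + 1) := by
  obtain hj | hj := le_or_gt j 2
  · suffices rootSpan F q k m n ≤
        (rootSpan F q k (m + j) (n + 1)).comap (LinearMap.mulRight F (rootVector F q k j)) from
      this ha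
    exact Submodule.span_le.2 fun b hb => Submodule.subset_span (hb.mul_rootVector hj)
  · rw [rootVector_eq_zero k hj, mul_zero]
    exact zero_mem _

theorem mul_gen_mem_rootSpan {k : Bool} {m n : ℤ} {a : UqPlus F q}
    (ha : a ∈ rootSpan F q k m n) : a * gen F q k ∈ rootSpan F q k (m + 1) n := by
  suffices rootSpan F q k m n ≤
      (rootSpan F q k (m + 1) n).comap (LinearMap.mulRight F (gen F q k)) from this ha
  clear ha
  refine Submodule.span_le.2 fun b hb => ?_
  change b * gen F q k ∈ rootSpan F q k (m + 1) n
  induction hb with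
  | pow a =>
    rw [← pow_succ]
    exact Submodule.subset_span (mod_cast IsRootMonomial.pow (a + 1))
  | @mul_rootVector m n a j hj h ih =>
    rw [mul_assoc, rootVector_mul_gen, mul_smul_comm, mul_sub, ← mul_assoc]
    refine Submodule.smul_mem _ _ (sub_mem ?_ ?_)
    · rw [add_right_comm]
      exact mul_rootVector_mem_rootSpan ih j
    · rw [add_assoc]
      exact mod_cast mul_rootVector_mem_rootSpan (Submodule.subset_span h) (j + 1)

theorem proj_mem_rootSpan (k : Bool) (γ : Bool → ℤ) (w : UqPlus F q) :
    proj γ w ∈ rootSpan F q k (γ k) (γ (!k)) := by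
  induction w using induction_right generalizing γ with
  | one =>
    rw [proj_one]
    split_ifs with h
    · subst h
      exact Submodule.subset_span (by simpa using IsRootMonomial.pow (F := F) (q := q) (k := k) 0)
    · exact zero_mem _
  | add a b ha hb => rw [map_add]; exact add_mem (ha γ) (hb γ)
  | smul c a ha => rw [map_smul]; exact Submodule.smul_mem _ c (ha γ)
  | mul_gen i a ha =>
    rw [proj_mul_gen]
    have h := ha (γ - simpleRoot i)
    obtain rfl | hi := eq_or_ne i k
    · simpa using mul_gen_mem_rootSpan h
    · obtain rfl : i = !k := Bool.eq_not.2 hi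
      simpa [rootVector] using mul_rootVector_mem_rootSpan h 0

/-- The operator whose eigenspaces separate the powers of the generator `k`. -/
def powerOp (k : Bool) : Module.End F (UqPlus F q) := LinearMap.mulLeft F (gen F q k) * derL k

theorem powerOp_apply (k : Bool) (w : UqPlus F q) : powerOp k w = gen F q k * derL k w := rfl

theorem powerOp_gen_pow (k : Bool) (a : ℕ) :
    powerOp k (gen F q k ^ a) = (∑ i ∈ Finset.range a, (q ^ 2) ^ i) • gen F q k ^ a := by
  rw [powerOp_apply]
  induction a with
  | zero => simp
  | succ a ih =>
    rw [pow_succ', derL_gen_mul, ih, rootTwist_self, geom_sum_succ, Pi.single_eq_same, one_smul,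
      mul_add, mul_smul_comm, mul_smul_comm, smul_smul, add_smul, one_smul, add_comm]

theorem geom_sum_sq_ne_zero {a : ℕ} (ha : 0 < a) : ∑ i ∈ Finset.range a, (q ^ 2) ^ i ≠ 0 := by
  intro h
  have hpow := geom_sum_mul (q ^ 2) a
  rw [h, zero_mul, eq_comm, sub_eq_zero, ← pow_mul] at hpow
  exact IsGeneric.pow_ne_one _ (by omega) hpow

theorem IsRootMonomial.exists_powerOp_eq {k : Bool} {m n : ℤ} {w : UqPlus F q}
    (h : IsRootMonomial k m n w) :
    ∃ a : ℕ, m ≤ a + 2 * n ∧ powerOp k w = (∑ i ∈ Finset.range a, (q ^ 2) ^ i) • w := by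
  induction h with
  | pow a => exact ⟨a, by omega, powerOp_gen_pow k a⟩
  | @mul_rootVector m n w j hj _ ih =>
    obtain ⟨a, ha, hw⟩ := ih
    have hroot : derL k (rootVector F q k j) = 0 :=
      derL_qCommutator_pow_eq_zero (by rw [derL, skewDer_gen]; simp) j
    rw [powerOp_apply] at hw
    refine ⟨a, by omega, ?_⟩
    rw [powerOp_apply, derL_mul, hroot, mul_zero, add_zero, ← mul_assoc, hw, smul_mul_assoc]

theorem eq_zero_of_mem_rootSpan {k : Bool} {m n : ℤ} {w : UqPlus F q}
    (hw : w ∈ rootSpan F q k m n) (hmn : 2 * n < m) (hder : derL k w = 0) : w = 0 := by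
  have hzero : w ∈ (powerOp k).eigenspace (0 : F) := by
    rw [Module.End.mem_eigenspace_iff, powerOp_apply, hder, mul_zero, zero_smul]
  refine Submodule.disjoint_def.1 ((powerOp k).eigenspaces_iSupIndep 0) w hzero ?_
  refine Submodule.span_le.2 (fun b hb => ?_) hw
  obtain ⟨a, ha, hb⟩ := hb.exists_powerOp_eq
  exact Submodule.mem_iSup_of_mem _ (Submodule.mem_iSup_of_mem (geom_sum_sq_ne_zero (by omega))
    (Module.End.mem_eigenspace_iff.2 hb))

end RootSpan

/-- A lowest weight vector of a locally nilpotent `U_q(sl₂)`-module cannot have positive weight: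
applying powers of `qCommutator k` never reaches zero, as `derR k` inverts each step up to a
scalar. -/
theorem eq_zero_of_lowest_weight [IsGeneric q] {k : Bool} {v : UqPlus F q} {γ : Bool → ℤ}
    (hv : proj γ v = v) (hγ : γ (!k) < γ k) (hL : derL k v = 0) (hR : derR k v = 0) : v = 0 := by
  have ht : q ^ 2 ≠ 0 := IsGeneric.sq_ne_zero
  obtain ⟨d, hd⟩ := Int.le.dest hγ.le
  have htwist : twist (!k) v = ((q ^ 2) ^ d)⁻¹ • v := by
    rw [← hv, twist_proj, Bool.not_not, ← hd, sub_add_cancel_left, zpow_neg, zpow_natCast]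
  have hnil : ∃ N, (qCommutator k ^ N) v = 0 := by
    refine ⟨(2 * γ (!k) - γ k + 1).toNat, ?_⟩
    have hmem := proj_mem_rootSpan k (γ + (2 * γ (!k) - γ k + 1).toNat • simpleRoot k)
      ((qCommutator k ^ (2 * γ (!k) - γ k + 1).toNat) v)
    rw [proj_qCommutator_pow hv] at hmem
    refine eq_zero_of_mem_rootSpan hmem ?_ (derL_qCommutator_pow_eq_zero hL _)
    simp only [Pi.add_apply, nsmul_eq_mul, Pi.mul_apply, Pi.natCast_apply, Int.ofNat_toNat, ne_eq,
      Bool.not_eq_eq_eq_not, Bool.eq_not_self, not_false_eq_true, Pi.single_eq_of_ne, mul_zero,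
      add_zero, Pi.single_eq_same, mul_one]
    omega
  have hscalar (i : ℕ) : ((q ^ 2) ^ (i + 1) - 1) * ((q ^ 2) ^ i - ((q ^ 2) ^ d)⁻¹ ^ 2) /
      ((q ^ 2 - 1) * (q ^ 2) ^ (2 * i)) ≠ 0 := by
    refine div_ne_zero (mul_ne_zero (sub_ne_zero.2 ?_) fun h => ?_)
      (mul_ne_zero (sub_ne_zero.2 IsGeneric.sq_ne_one) (pow_ne_zero _ ht))
    · rw [← pow_mul]
      exact IsGeneric.pow_ne_one _ (by omega)
    · refine IsGeneric.pow_ne_one (q := q) (2 * (i + d * 2)) (by omega) ?_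
      rw [pow_mul, pow_add, pow_mul, sub_eq_zero.1 h, inv_pow,
        inv_mul_cancel₀ (pow_ne_zero _ (pow_ne_zero _ ht))]
  obtain ⟨N, hN⟩ := hnil
  induction N with
  | zero => exact hN
  | succ N ih =>
    have hlower := derR_qCommutator_pow_succ htwist hR N
    rw [hN, map_zero, eq_comm, smul_eq_zero] at hlower
    exact ih (hlower.resolve_left (hscalar N))

/-! ### Nondegeneracy -/

section Primitive

variable [IsGeneric q] {v : UqPlus F q} {γ : Bool → ℤ}

theorem degree_eq_of_der_eq_zero (hL : ∀ k, derL k v = 0) (hR : ∀ k, derR k v = 0)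
    (hγ : proj γ v ≠ 0) : γ false = γ true := by
  have key (k : Bool) : γ k ≤ γ (!k) := by
    by_contra! hlt
    refine hγ (eq_zero_of_lowest_weight (proj_proj γ v) hlt ?_ ?_)
    · rw [derL_proj, hL, map_zero]
    · rw [derR_proj, hR, map_zero]
  exact le_antisymm (key false) (key true)

theorem degree_eq_zero_of_antipode_eq_neg (hS : antipode v = -v) (hγ : proj γ v ≠ 0)
    (h : γ false = γ true) : γ = 0 := by
  have hfix : (q ^ 2) ^ ((γ false - γ true) ^ 2 - (γ false + γ true)) • proj γ v = proj γ v := by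
    rw [← antipode_antipode_proj, ← proj_antipode, ← proj_antipode, hS, map_neg, hS, neg_neg]
  have hpow := smul_left_injective F hγ (hfix.trans (one_smul F _).symm)
  have hnonneg : 0 ≤ γ true := by
    by_contra! hlt
    exact hγ (proj_eq_zero_of_neg true hlt v)
  rw [h, sub_self, zero_pow two_ne_zero, zero_sub, zpow_neg, inv_eq_one,
    ← Int.toNat_of_nonneg (by omega : 0 ≤ γ true + γ true), zpow_natCast, ← pow_mul] at hpow
  have htrue : γ true = 0 := by
    by_contra hne
    exact IsGeneric.pow_ne_one _ (by omega) hpow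
  funext j
  cases j
  · exact h.trans htrue
  · exact htrue

theorem eq_counit_of_antipode_eq_neg (hL : ∀ k, derL k v = 0) (hR : ∀ k, derR k v = 0)
    (hS : antipode v = -v) : v = counit v • 1 := by
  refine eq_counit_of_proj_eq_zero fun γ hγ => ?_
  by_contra hne
  exact hγ (degree_eq_zero_of_antipode_eq_neg hS hne (degree_eq_of_der_eq_zero hL hR hne))

end Primitive

section Kernel

variable [IsGeneric q] {v : UqPlus F q}

theorem eq_counit_of_mem_lengthLT {n : ℕ} (hn : v ∈ lengthLT F q n) (hL : ∀ k, derL k v = 0) :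
    v = counit v • 1 := by
  induction n generalizing v with
  | zero => rw [(Submodule.mem_bot F).1 hn, map_zero, zero_smul]
  | succ n ih =>
    wlog h0 : counit v = 0 generalizing v
    · have hzero := this (v := v - counit v • 1)
        (sub_mem hn (Submodule.smul_mem _ _ (one_mem_lengthLT n))) (fun k => by simp [hL])
        (by simp)
      simpa [sub_eq_zero] using hzero
    have hR (k : Bool) : derR k v = 0 := by
      have hmem : derR k v ∈ lengthLT F q n := skewDer_mem_lengthLT _ _ hn
      rw [ih hmem fun j => by rw [derL_derR, hL, map_zero, smul_zero], counit_derR, hL, map_zero,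
        zero_smul]
    exact eq_counit_of_antipode_eq_neg hL hR (antipode_eq_neg_of_primitive
      (coproduct_eq_of_derL_eq_zero (fun w hw h => ih hw h) hn hL h0) h0)

theorem eq_counit_of_derL_eq_zero (hL : ∀ k, derL k v = 0) : v = counit v • 1 := by
  obtain ⟨n, hn⟩ := exists_mem_lengthLT v
  exact eq_counit_of_mem_lengthLT hn hL

theorem eq_zero_of_counit_derWord_eq_zero (h : ∀ l, counit (derWord l v) = 0) : v = 0 := by
  obtain ⟨n, hn⟩ := exists_mem_lengthLT v
  induction n generalizing v with
  | zero => exact (Submodule.mem_bot F).1 hn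
  | succ n ih =>
    have hL (k : Bool) : derL k v = 0 :=
      ih (fun l => by rw [← derWord_concat, h]) (skewDer_mem_lengthLT _ _ hn)
    rw [eq_counit_of_derL_eq_zero hL, ← derWord_nil v, h, zero_smul]

end Kernel

/-! ### Lowering operators -/

/-- The operator by which the lowering generator of `□_q` attached to `k` acts on `UqPlus F q`; its
values on the generators are the constants in the solved form of the `q`-Weyl relations. -/
def lower [IsGeneric q] (k : Bool) : UqPlus F q →ₗ[F] UqPlus F q :=
  skewDer k fun j => 1 - rootTwist q k j

section Lower

variable [IsGeneric q]

@[simp]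
theorem lower_one (k : Bool) : lower k (1 : UqPlus F q) = 0 := skewDer_one _ _

theorem lower_gen_mul (k j : Bool) (w : UqPlus F q) :
    lower k (gen F q j * w) =
      (1 - rootTwist q k j) • w + rootTwist q k j • (gen F q j * lower k w) :=
  skewDer_gen_mul _ _ _ _

theorem lower_eq (k : Bool) (w : UqPlus F q) :
    lower k w = (1 - q ^ 2) • (derL k w - (q ^ 2)⁻¹ • derR (!k) w) := by
  have ht : q ^ 2 ≠ 0 := IsGeneric.sq_ne_zero
  rw [lower, skewDer_eq, rootTwist_not_right, rootTwist_self]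
  generalize q ^ 2 = t at ht
  match_scalars <;> field_simp
  ring

theorem eq_counit_of_lower_eq_zero {v : UqPlus F q} (h : ∀ k, lower k v = 0) :
    v = counit v • 1 := by
  have hrot (i : Bool) : derL i v = (q ^ 2)⁻¹ • derR (!i) v := by
    have hi := h i
    rw [lower_eq, smul_eq_zero] at hi
    exact sub_eq_zero.1 (hi.resolve_left (sub_ne_zero.2 IsGeneric.sq_ne_one.symm))
  exact eq_counit_of_derL_eq_zero fun k => eq_zero_of_counit_derWord_eq_zero fun l => by
    rw [← derWord_concat, counit_derWord_eq_zero hrot (List.concat_ne_nil k l)]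

theorem lower_mul_lmul_gen (k j : Bool) :
    (lower k * Algebra.lmul F (UqPlus F q) (gen F q j) : Module.End F (UqPlus F q)) =
      (1 - rootTwist q k j) • 1 +
        rootTwist q k j • (Algebra.lmul F (UqPlus F q) (gen F q j) * lower k) :=
  LinearMap.ext fun w => lower_gen_mul k j w

theorem qSerre_lower (k : Bool) :
    qSerre q (lower k : Module.End F (UqPlus F q)) (lower (!k)) = 0 := by
  refine linearMap_ext ?_ fun j a ha => ?_
  · simp [qSerre, pow_succ]
  · have hnot := lower_mul_lmul_gen (F := F) (q := q) (!k) j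
    rw [rootTwist_not_left] at hnot
    have hcomm := qSerre_mul_of_skew (q := q) (t := rootTwist q k j) (rootTwist_ne_zero k j)
      (qInt_three_eq_rootTwist k j) (lower_mul_lmul_gen k j) hnot
    generalize qSerre q (lower k : Module.End F (UqPlus F q)) (lower (!k)) = S at ha hcomm ⊢
    calc S (gen F q j * a) = rootTwist q k j ^ 2 • (gen F q j * S a) :=
          LinearMap.congr_fun hcomm a
      _ = 0 := by rw [ha, LinearMap.zero_apply, mul_zero, smul_zero]

end Lower

/-- The endomorphism that multiplies words of length `n` by `q ^ n`. -/
def scale : UqPlus F q →ₐ[F] UqPlus F q :=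
  lift (fun i => q • gen F q i) fun i => by rw [qSerre_smul_smul, qSerre_gen, smul_zero]

@[simp]
theorem scale_gen (i : Bool) : scale (gen F q i) = q • gen F q i := lift_gen _ _ _

end UqPlus

/-! ### The algebra `□_q` -/

theorem eq_of_le_of_iSupIndep_of_iSup_eq_top {α : Type u} [CompleteLattice α] [IsModularLattice α]
    {ι : Type v} {S T : ι → α} (hle : T ≤ S) (hS : iSupIndep S) (hT : ⨆ i, T i = ⊤) : T = S := by
  funext i
  refine eq_of_le_of_inf_le_of_sup_le (hle i) (z := ⨆ (j) (_ : j ≠ i), T j) ?_ ?_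
  · exact ((hS i).mono_right (iSup₂_mono fun j _ => hle j)).le_bot.trans bot_le
  · rw [← iSup_split_single, hT]
    exact le_top

namespace SquareAlgebra

variable {F : Type u} [Field F] {q : F}

section Presentation

theorem adjoin_x : Algebra.adjoin F (Set.range (x F q)) = ⊤ := by
  have h := congrArg (Subalgebra.map (RingQuot.mkAlgHom F (SquareRel F q)))
    (FreeAlgebra.adjoin_range_ι F (ZMod 4))
  rw [AlgHom.map_adjoin, ← Set.range_comp, Algebra.map_top] at h
  exact h.trans ((AlgHom.range_eq_top _).2 (RingQuot.mkAlgHom_surjective F _))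

theorem qSerre_x (i : ZMod 4) : qSerre q (x F q i) (x F q (i + 2)) = 0 := by
  have hrel := RingQuot.mkAlgHom_rel F (SquareRel.qSerre (F := F) (q := q) i)
  rw [map_zero] at hrel
  rw [← hrel]
  simp only [qSerre, x, map_sub, map_add, map_mul, map_pow, map_smul]

theorem qWeyl_x (i : ZMod 4) : (q - q⁻¹)⁻¹ • (q • (x F q i * x F q (i + 1)) -
    q⁻¹ • (x F q (i + 1) * x F q i)) = 1 := by
  have hrel := RingQuot.mkAlgHom_rel F (SquareRel.qWeyl (F := F) (q := q) i)
  rw [map_one] at hrel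
  rw [← hrel]
  simp only [x, map_sub, map_mul, map_smul]

section QWeyl

variable [IsGeneric q] {R : Type v} [Ring R] [Algebra F R] {a b : R}

theorem qWeyl_iff : (q - q⁻¹)⁻¹ • (q • (a * b) - q⁻¹ • (b * a)) = 1 ↔
    b * a = (1 - q ^ 2) • 1 + q ^ 2 • (a * b) := by
  have h0 : q ≠ 0 := IsGeneric.ne_zero
  have hd : q - q⁻¹ ≠ 0 := IsGeneric.sub_inv_ne_zero
  have hsub : b * a - ((1 - q ^ 2) • 1 + q ^ 2 • (a * b)) = -(q * (q - q⁻¹)) •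
      ((q - q⁻¹)⁻¹ • (q • (a * b) - q⁻¹ • (b * a)) - 1) := by
    rw [smul_sub, smul_smul, neg_mul, mul_assoc, mul_inv_cancel₀ hd, mul_one]
    match_scalars <;> field_simp
    ring
  rw [← sub_eq_zero, ← sub_eq_zero (a := b * a), hsub, smul_eq_zero,
    or_iff_right (neg_ne_zero.2 (mul_ne_zero h0 hd))]

theorem qWeyl_iff_inv : (q - q⁻¹)⁻¹ • (q • (a * b) - q⁻¹ • (b * a)) = 1 ↔
    a * b = (1 - (q ^ 2)⁻¹) • 1 + (q ^ 2)⁻¹ • (b * a) := by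
  have h0 : q ≠ 0 := IsGeneric.ne_zero
  rw [qWeyl_iff]
  constructor <;> intro h <;> rw [h] <;> match_scalars <;> field_simp <;> ring

end QWeyl

/-- The index of the raising generator of `□_q` attached to a generator of `UqPlus F q`. -/
def up : Bool → ZMod 4
  | false => 0
  | true => 2

/-- The index of the lowering generator of `□_q` attached to a generator of `UqPlus F q`, so that
`x (down i)` and `x (up i)` are related by `qWeyl_iff`. -/
def down : Bool → ZMod 4
  | false => 1
  | true => 3

theorem forall_index {P : ZMod 4 → Prop} : (∀ i, P i) ↔ (∀ i, P (up i)) ∧ ∀ i, P (down i) := by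
  refine ⟨fun h => ⟨fun i => h _, fun i => h _⟩, fun ⟨hu, hd⟩ i => ?_⟩
  fin_cases i
  exacts [hu false, hd false, hu true, hd true]

theorem qSerre_x_up (i : Bool) : qSerre q (x F q (up i)) (x F q (up !i)) = 0 := by
  cases i
  exacts [qSerre_x 0, qSerre_x 2]

variable [IsGeneric q]

theorem x_down_mul_x_up (k j : Bool) : x F q (down k) * x F q (up j) =
    (1 - UqPlus.rootTwist q k j) • 1 +
      UqPlus.rootTwist q k j • (x F q (up j) * x F q (down k)) := by
  cases k <;> cases j
  exacts [qWeyl_iff.1 (qWeyl_x 0), qWeyl_iff_inv.1 (qWeyl_x 1), qWeyl_iff_inv.1 (qWeyl_x 3),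
    qWeyl_iff.1 (qWeyl_x 2)]

end Presentation

section Representation

variable [IsGeneric q]

/-- The images of the generators of `□_q` in a representation with raising operators `e` and
lowering operators `f`. -/
def generatorImage {R : Type v} (e f : Bool → R) (i : ZMod 4) : R :=
  if i = 0 then e false else if i = 1 then f false else if i = 2 then e true else f true

/-- The representation of `□_q` given by raising operators `e` and lowering operators `f`. -/
def lift {R : Type v} [Ring R] [Algebra F R] (e f : Bool → R)
    (he : ∀ i, qSerre q (e i) (e (!i)) = 0) (hf : ∀ i, qSerre q (f i) (f (!i)) = 0)
    (hfe : ∀ k j, f k * e j =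
      (1 - UqPlus.rootTwist q k j) • 1 + UqPlus.rootTwist q k j • (e j * f k)) :
    SquareAlgebra F q →ₐ[F] R :=
  RingQuot.liftAlgHom F ⟨FreeAlgebra.lift F (generatorImage e f), by
    rintro _ _ (i | i)
    · simp only [map_smul, map_sub, map_mul, FreeAlgebra.lift_ι_apply, map_one]
      fin_cases i
      exacts [qWeyl_iff.2 (hfe false false), qWeyl_iff_inv.2 (hfe false true),
        qWeyl_iff.2 (hfe true true), qWeyl_iff_inv.2 (hfe true false)]
    · simp only [map_smul, map_sub, map_add, map_mul, map_pow, FreeAlgebra.lift_ι_apply, map_zero]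
      fin_cases i
      exacts [he false, hf false, he true, hf true]⟩

section

variable {R : Type v} [Ring R] [Algebra F R] {e f : Bool → R}
  (he : ∀ i, qSerre q (e i) (e (!i)) = 0) (hf : ∀ i, qSerre q (f i) (f (!i)) = 0)
  (hfe : ∀ k j, f k * e j =
    (1 - UqPlus.rootTwist q k j) • 1 + UqPlus.rootTwist q k j • (e j * f k))

theorem lift_x_up (i : Bool) : lift e f he hf hfe (x F q (up i)) = e i := by
  rw [lift, x, RingQuot.liftAlgHom_mkAlgHom_apply, FreeAlgebra.lift_ι_apply]
  cases i <;> rfl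

theorem lift_x_down (i : Bool) : lift e f he hf hfe (x F q (down i)) = f i := by
  rw [lift, x, RingQuot.liftAlgHom_mkAlgHom_apply, FreeAlgebra.lift_ι_apply]
  cases i <;> rfl

end

/-- The representation of `□_q` on `UqPlus F q` by left multiplications and lowering operators. -/
def rep : SquareAlgebra F q →ₐ[F] Module.End F (UqPlus F q) :=
  lift (fun i => Algebra.lmul F (UqPlus F q) (UqPlus.gen F q i)) UqPlus.lower
    (fun i => by rw [← map_qSerre, UqPlus.qSerre_gen, map_zero])
    UqPlus.qSerre_lower UqPlus.lower_mul_lmul_gen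

theorem rep_x_up (i : Bool) :
    rep (x F q (up i)) = Algebra.lmul F (UqPlus F q) (UqPlus.gen F q i) := lift_x_up _ _ _ i

theorem rep_x_down (i : Bool) : rep (x F q (down i)) = UqPlus.lower i := lift_x_down _ _ _ i

end Representation

end SquareAlgebra

namespace UqPlus

variable {F : Type u} [Field F] {q : F} [IsGeneric q]

instance : Module (SquareAlgebra F q) (UqPlus F q) :=
  Module.compHom _ (SquareAlgebra.rep (F := F) (q := q)).toRingHom

theorem squareAlgebra_smul_def (a : SquareAlgebra F q) (w : UqPlus F q) :
    a • w = SquareAlgebra.rep a w := rfl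

instance : IsScalarTower F (SquareAlgebra F q) (UqPlus F q) where
  smul_assoc c a w := by
    rw [squareAlgebra_smul_def, squareAlgebra_smul_def, map_smul, LinearMap.smul_apply]

open SquareAlgebra

theorem x_up_smul (i : Bool) (w : UqPlus F q) : x F q (up i) • w = gen F q i * w := by
  rw [squareAlgebra_smul_def, rep_x_up, Algebra.coe_lmul_eq_mul, LinearMap.mul_apply']

theorem x_down_smul (i : Bool) (w : UqPlus F q) : x F q (down i) • w = lower i w := by
  rw [squareAlgebra_smul_def, rep_x_down]

end UqPlus

/-! ### NIL vectors -/

section NILVector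

open SquareAlgebra

variable {F : Type u} [Field F] {q : F} {V : Type v} [AddCommGroup V]
  [Module (SquareAlgebra F q) V] {ξ : V}

theorem isNILVector_iff : IsNILVector F q ξ ↔ (∀ k, x F q (down k) • ξ = 0) ∧ ξ ≠ 0 := by
  rw [IsNILVector, Bool.forall_bool, and_assoc]
  rfl

theorem IsNILVector.x_down_smul (hξ : IsNILVector F q ξ) (k : Bool) : x F q (down k) • ξ = 0 :=
  (isNILVector_iff.1 hξ).1 k

theorem IsNILVector.ne_zero (hξ : IsNILVector F q ξ) : ξ ≠ 0 := hξ.2.2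

end NILVector

namespace UqPlus

variable {F : Type u} [Field F] {q : F} [IsGeneric q]

theorem isNILVector_one : IsNILVector F q (1 : UqPlus F q) := by
  refine isNILVector_iff.2 ⟨fun k => by rw [x_down_smul, lower_one], fun h => ?_⟩
  simpa using congrArg (counit (F := F) (q := q)) h

theorem isGeneratedBy_one : IsGeneratedBy F q (1 : UqPlus F q) := by
  refine fun W hW => eq_top_iff.2 fun w _ => ?_
  induction w using induction_left with
  | one => exact hW
  | add a b ha hb => exact W.add_mem (ha trivial) (hb trivial)
  | smul c a ha => exact W.smul_of_tower_mem c (ha trivial)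
  | gen_mul i a ha => rw [← x_up_smul]; exact W.smul_mem _ (ha trivial)

end UqPlus

section Orbit

open SquareAlgebra

variable {F : Type u} [Field F] {q : F} {V : Type v} [AddCommGroup V] [Module F V]
  [Module (SquareAlgebra F q) V] [IsScalarTower F (SquareAlgebra F q) V]

/-- The homomorphism of `UqPlus F q` to `□_q` given by the raising generators. -/
def raising : UqPlus F q →ₐ[F] SquareAlgebra F q :=
  UqPlus.lift (fun i => x F q (up i)) qSerre_x_up

/-- The map `w ↦ w ξ`, where `UqPlus F q` acts on `V` through the raising generators. -/
def orbit (ξ : V) : UqPlus F q →ₗ[F] V :=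
  (LinearMap.toSpanSingleton (SquareAlgebra F q) V ξ).restrictScalars F ∘ₗ raising.toLinearMap

theorem orbit_apply (ξ : V) (w : UqPlus F q) : orbit ξ w = raising w • ξ := rfl

theorem orbit_one (ξ : V) : orbit ξ (1 : UqPlus F q) = ξ := by
  rw [orbit_apply, map_one, one_smul]

theorem orbit_gen_mul (ξ : V) (i : Bool) (w : UqPlus F q) :
    orbit ξ (UqPlus.gen F q i * w) = x F q (up i) • orbit ξ w := by
  rw [orbit_apply, map_mul, mul_smul, raising, UqPlus.lift_gen, orbit_apply, raising]

end Orbit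

namespace IsNILVector

open SquareAlgebra

variable {F : Type u} [Field F] {q : F} [IsGeneric q] {V : Type v} [AddCommGroup V] [Module F V]
  [Module (SquareAlgebra F q) V] [IsScalarTower F (SquareAlgebra F q) V] {ξ ζ : V}

theorem orbit_lower (hξ : IsNILVector F q ξ) (k : Bool) (w : UqPlus F q) :
    orbit ξ (UqPlus.lower k w) = x F q (down k) • orbit ξ w := by
  have : SMulCommClass F (SquareAlgebra F q) V := IsScalarTower.to_smulCommClass
  induction w using UqPlus.induction_left with
  | one => rw [UqPlus.lower_one, map_zero, orbit_one, hξ.x_down_smul]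
  | add a b ha hb => simp only [map_add, ha, hb, smul_add]
  | smul c a ha => rw [map_smul, map_smul, map_smul, ha, smul_comm]
  | gen_mul i a ha =>
    rw [UqPlus.lower_gen_mul, map_add, map_smul, map_smul, orbit_gen_mul, ha, orbit_gen_mul,
      ← mul_smul (x F q (down k)), x_down_mul_x_up, add_smul, smul_assoc, smul_assoc, one_smul,
      mul_smul]

theorem orbit_smul (hξ : IsNILVector F q ξ) (a : SquareAlgebra F q) (w : UqPlus F q) :
    orbit ξ (a • w) = a • orbit ξ w := by
  have ha : a ∈ Algebra.adjoin F (Set.range (x F q)) := by rw [adjoin_x]; exact Algebra.mem_top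
  induction ha using Algebra.adjoin_induction generalizing w with
  | mem _ h =>
    obtain ⟨i, rfl⟩ := h
    revert i
    refine forall_index.2 ⟨fun i => ?_, fun i => ?_⟩
    · rw [UqPlus.x_up_smul, orbit_gen_mul]
    · rw [UqPlus.x_down_smul, hξ.orbit_lower]
  | algebraMap c => rw [algebraMap_smul, algebraMap_smul, map_smul]
  | add a b _ _ ha hb => rw [add_smul, add_smul, map_add, ha, hb]
  | mul a b _ _ ha hb => rw [mul_smul, mul_smul, ha, hb]

theorem orbit_injective (hξ : IsNILVector F q ξ) : Function.Injective (orbit (q := q) ξ) := by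
  refine (injective_iff_map_eq_zero _).2 fun w hw => ?_
  obtain ⟨n, hn⟩ := UqPlus.exists_mem_lengthLT w
  induction n generalizing w with
  | zero => exact (Submodule.mem_bot F).1 hn
  | succ n ih =>
    have hscalar := UqPlus.eq_counit_of_lower_eq_zero fun k =>
      ih (UqPlus.lower k w) (by rw [hξ.orbit_lower, hw, smul_zero])
        (UqPlus.skewDer_mem_lengthLT _ _ hn)
    rw [hscalar, map_smul, orbit_one, smul_eq_zero] at hw
    rw [hscalar, hw.resolve_right hξ.ne_zero, zero_smul]

/-- The orbit map of a NIL vector as a homomorphism of `□_q`-modules. -/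
def orbitHom (hξ : IsNILVector F q ξ) : UqPlus F q →ₗ[SquareAlgebra F q] V where
  toFun := orbit ξ
  map_add' := map_add _
  map_smul' := hξ.orbit_smul

theorem orbit_surjective (hξ : IsNILVector F q ξ) (hg : IsGeneratedBy F q ξ) :
    Function.Surjective (orbit (q := q) ξ) :=
  have htop := hg (LinearMap.range hξ.orbitHom) ⟨1, orbit_one ξ⟩
  fun y => LinearMap.range_eq_top.1 htop y

/-- The isomorphism of `UqPlus F q` with a NIL module. -/
noncomputable def orbitEquiv (hξ : IsNILVector F q ξ) (hg : IsGeneratedBy F q ξ) :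
    UqPlus F q ≃ₗ[SquareAlgebra F q] V :=
  LinearEquiv.ofBijective hξ.orbitHom ⟨hξ.orbit_injective, hξ.orbit_surjective hg⟩

theorem exists_eq_smul (hζ : IsNILVector F q ζ) (hξ : IsNILVector F q ξ)
    (hg : IsGeneratedBy F q ξ) : ∃ c : F, c ≠ 0 ∧ ζ = c • ξ := by
  obtain ⟨w, rfl⟩ := hξ.orbit_surjective hg ζ
  have hscalar := UqPlus.eq_counit_of_lower_eq_zero (v := w) fun k => hξ.orbit_injective (by
    rw [hξ.orbit_lower, hζ.x_down_smul, map_zero])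
  have hsmul : orbit ξ w = UqPlus.counit w • ξ := by
    conv_lhs => rw [hscalar, map_smul, orbit_one]
  refine ⟨_, fun h0 => hζ.ne_zero ?_, hsmul⟩
  rw [hsmul, h0, zero_smul]

theorem isGeneratedBy (hζ : IsNILVector F q ζ) (hξ : IsNILVector F q ξ)
    (hg : IsGeneratedBy F q ξ) : IsGeneratedBy F q ζ := by
  obtain ⟨c, hc, rfl⟩ := hζ.exists_eq_smul hξ hg
  exact fun W hW => hg W ((W.smul_mem_iff' (Units.mk0 c hc)).1 hW)

end IsNILVector

/-! ### Words in the raising generators -/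

section Words

open SquareAlgebra

variable {F : Type u} [Field F] {q : F} {V : Type v} [AddCommGroup V]
  [Module (SquareAlgebra F q) V]

theorem wordVectors_zero (ξ : V) : wordVectors F q ξ 0 = {ξ} := by
  ext y
  simp [wordVectors]

theorem mem_wordVectors_succ {ξ y : V} {n : ℕ} : y ∈ wordVectors F q ξ (n + 1) ↔
    ∃ i, ∃ z ∈ wordVectors F q ξ n, y = x F q (up i) • z := by
  simp only [wordVectors, Set.mem_ofPred_eq, Bool.exists_bool, up, Fin.exists_fin_succ_pi,
    Fin.forall_fin_succ, Fin.cons_zero, Fin.cons_succ, List.ofFn_succ, List.prod_cons, mul_smul]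
  constructor
  · rintro ⟨_, u, ⟨rfl | rfl, hu⟩, rfl⟩
    exacts [.inl ⟨_, ⟨u, hu, rfl⟩, rfl⟩, .inr ⟨_, ⟨u, hu, rfl⟩, rfl⟩]
  · rintro (⟨_, ⟨u, hu, rfl⟩, rfl⟩ | ⟨_, ⟨u, hu, rfl⟩, rfl⟩)
    exacts [⟨_, u, ⟨.inl rfl, hu⟩, rfl⟩, ⟨_, u, ⟨.inr rfl, hu⟩, rfl⟩]

variable [Module F V]

theorem IsNILDecomposition.x_up_smul_mem {S : ℕ → Submodule F V} (hS : IsNILDecomposition F q S)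
    {n : ℕ} {y : V} (hy : y ∈ S n) (i : Bool) : x F q (up i) • y ∈ S (n + 1) := by
  cases i
  exacts [hS.x_zero_smul_mem n y hy, hS.x_two_smul_mem n y hy]

theorem IsNILDecomposition.isNILVector {S : ℕ → Submodule F V} (hS : IsNILDecomposition F q S)
    {y : V} (hy : y ∈ S 0) (h0 : y ≠ 0) : IsNILVector F q y :=
  ⟨(Submodule.mem_bot F).1 (hS.x_one_smul_mem 0 y hy),
    (Submodule.mem_bot F).1 (hS.x_three_smul_mem 0 y hy), h0⟩

theorem IsNILDecomposition.span_wordVectors_le {S : ℕ → Submodule F V}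
    (hS : IsNILDecomposition F q S) {ξ : V} (hξ : ξ ∈ S 0) (n : ℕ) :
    Submodule.span F (wordVectors F q ξ n) ≤ S n := by
  refine Submodule.span_le.2 ?_
  induction n with
  | zero => rwa [wordVectors_zero, Set.singleton_subset_iff]
  | succ n ih =>
    intro y hy
    obtain ⟨i, z, hz, rfl⟩ := mem_wordVectors_succ.1 hy
    exact hS.x_up_smul_mem (ih hz) i

variable [IsScalarTower F (SquareAlgebra F q) V]

theorem x_up_smul_mem_span_wordVectors {ξ y : V} {n : ℕ}
    (hy : y ∈ Submodule.span F (wordVectors F q ξ n)) (i : Bool) :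
    x F q (up i) • y ∈ Submodule.span F (wordVectors F q ξ (n + 1)) := by
  have hle : Submodule.span F (wordVectors F q ξ n) ≤
      (Submodule.span F (wordVectors F q ξ (n + 1))).comap (Algebra.lsmul F F V (x F q (up i))) :=
    Submodule.span_le.2 fun z hz =>
      Submodule.subset_span (mem_wordVectors_succ.2 ⟨i, z, hz, rfl⟩)
  exact hle hy

theorem IsNILVector.x_down_smul_mem_span_wordVectors [IsGeneric q] {ξ y : V}
    (hξ : IsNILVector F q ξ) {n : ℕ} (hy : y ∈ Submodule.span F (wordVectors F q ξ n))
    (k : Bool) :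
    x F q (down k) • y ∈ prevSubspace (fun n => Submodule.span F (wordVectors F q ξ n)) n := by
  suffices hle : Submodule.span F (wordVectors F q ξ n) ≤
      (prevSubspace (fun n => Submodule.span F (wordVectors F q ξ n)) n).comap
        (Algebra.lsmul F F V (x F q (down k))) from hle hy
  clear hy
  refine Submodule.span_le.2 ?_
  induction n with
  | zero =>
    rw [wordVectors_zero, Set.singleton_subset_iff]
    exact (Submodule.mem_bot F).2 (hξ.x_down_smul k)
  | succ n ih =>
    intro _ hy
    obtain ⟨i, z, hz, rfl⟩ := mem_wordVectors_succ.1 hy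
    change x F q (down k) • x F q (up i) • z ∈ Submodule.span F (wordVectors F q ξ n)
    rw [← mul_smul, x_down_mul_x_up, add_smul, smul_assoc, smul_assoc, one_smul, mul_smul]
    refine Submodule.add_mem _ (Submodule.smul_mem _ _ (Submodule.subset_span hz))
      (Submodule.smul_mem _ _ ?_)
    have hdown := ih hz
    cases n with
    | zero =>
      have hzero : x F q (down k) • z = 0 := (Submodule.mem_bot F).1 hdown
      rw [hzero, smul_zero]
      exact Submodule.zero_mem _
    | succ n => exact x_up_smul_mem_span_wordVectors hdown i

theorem orbit_mem_iSup_span_wordVectors (ξ : V) (w : UqPlus F q) :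
    orbit ξ w ∈ ⨆ n, Submodule.span F (wordVectors F q ξ n) := by
  induction w using UqPlus.induction_left with
  | one =>
    refine Submodule.mem_iSup_of_mem 0 (Submodule.subset_span ?_)
    rw [orbit_one, wordVectors_zero, Set.mem_singleton_iff]
  | add a b ha hb => rw [map_add]; exact Submodule.add_mem _ ha hb
  | smul c a ha => rw [map_smul]; exact Submodule.smul_mem _ _ ha
  | gen_mul i a ha =>
    have hle : ⨆ n, Submodule.span F (wordVectors F q ξ n) ≤
        (⨆ n, Submodule.span F (wordVectors F q ξ n)).comap
          (Algebra.lsmul F F V (x F q (up i))) :=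
      iSup_le fun n z hz =>
        Submodule.mem_iSup_of_mem (n + 1) (x_up_smul_mem_span_wordVectors hz i)
    rw [orbit_gen_mul]
    exact hle ha

theorem span_wordVectors_le_map_eigenspace_scale (ξ : V) (n : ℕ) :
    Submodule.span F (wordVectors F q ξ n) ≤
      (Module.End.eigenspace (UqPlus.scale (q := q)).toLinearMap (q ^ n)).map (orbit ξ) := by
  refine Submodule.span_le.2 ?_
  induction n with
  | zero =>
    rw [wordVectors_zero, Set.singleton_subset_iff]
    exact ⟨1, Module.End.mem_eigenspace_iff.2 (by simp), orbit_one ξ⟩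
  | succ n ih =>
    intro _ hy
    obtain ⟨i, z, hz, rfl⟩ := mem_wordVectors_succ.1 hy
    obtain ⟨w, hw, rfl⟩ := ih hz
    have hscale : UqPlus.scale w = q ^ n • w := Module.End.mem_eigenspace_iff.1 hw
    refine ⟨UqPlus.gen F q i * w, Module.End.mem_eigenspace_iff.2 ?_, orbit_gen_mul ξ i w⟩
    rw [AlgHom.toLinearMap_apply, map_mul, hscale, UqPlus.scale_gen, smul_mul_assoc,
      mul_smul_comm, smul_smul, pow_succ']

end Words

section Decomposition

variable {F : Type u} [Field F] {q : F} [IsGeneric q] {V : Type v} [AddCommGroup V] [Module F V]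
  [Module (SquareAlgebra F q) V] [IsScalarTower F (SquareAlgebra F q) V] {ξ : V}

theorem IsNILVector.iSupIndep_span_wordVectors (hξ : IsNILVector F q ξ) :
    iSupIndep fun n => Submodule.span F (wordVectors F q ξ n) :=
  (LinearMap.iSupIndep_map (orbit ξ) hξ.orbit_injective
    ((Module.End.eigenspaces_iSupIndep _).comp IsGeneric.pow_injective)).mono
    (span_wordVectors_le_map_eigenspace_scale ξ)

theorem IsNILVector.iSup_span_wordVectors (hξ : IsNILVector F q ξ) (hg : IsGeneratedBy F q ξ) :
    ⨆ n, Submodule.span F (wordVectors F q ξ n) = ⊤ := by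
  refine eq_top_iff.2 fun y _ => ?_
  obtain ⟨w, rfl⟩ := hξ.orbit_surjective hg y
  exact orbit_mem_iSup_span_wordVectors ξ w

theorem IsNILVector.isNILDecomposition_span_wordVectors (hξ : IsNILVector F q ξ)
    (hg : IsGeneratedBy F q ξ) :
    IsNILDecomposition F q fun n => Submodule.span F (wordVectors F q ξ n) where
  zero_ne_bot := by
    rw [wordVectors_zero, Ne, Submodule.span_singleton_eq_bot]
    exact hξ.ne_zero
  isInternal := DirectSum.isInternal_submodule_of_iSupIndep_of_iSup_eq_top
    hξ.iSupIndep_span_wordVectors (hξ.iSup_span_wordVectors hg)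
  x_zero_smul_mem _ _ hy := x_up_smul_mem_span_wordVectors hy false
  x_one_smul_mem _ _ hy := hξ.x_down_smul_mem_span_wordVectors hy false
  x_two_smul_mem _ _ hy := x_up_smul_mem_span_wordVectors hy true
  x_three_smul_mem _ _ hy := hξ.x_down_smul_mem_span_wordVectors hy true

namespace IsNILDecomposition

variable {S : ℕ → Submodule F V}

theorem mem_zero (hS : IsNILDecomposition F q S) (hξ : IsNILVector F q ξ)
    (hg : IsGeneratedBy F q ξ) : ξ ∈ S 0 := by
  obtain ⟨y, hy, h0⟩ := Submodule.exists_mem_ne_zero_of_ne_bot hS.zero_ne_bot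
  obtain ⟨c, hc, rfl⟩ := (hS.isNILVector hy h0).exists_eq_smul hξ hg
  exact (Submodule.smul_mem_iff _ hc).1 hy

theorem eq_span_wordVectors (hS : IsNILDecomposition F q S) (hξ : IsNILVector F q ξ)
    (hg : IsGeneratedBy F q ξ) : S = fun n => Submodule.span F (wordVectors F q ξ n) :=
  (eq_of_le_of_iSupIndep_of_iSup_eq_top (hS.span_wordVectors_le (hS.mem_zero hξ hg))
    hS.isInternal.submodule_iSupIndep (hξ.iSup_span_wordVectors hg)).symm

theorem finrank_zero (hS : IsNILDecomposition F q S) (hξ : IsNILVector F q ξ)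
    (hg : IsGeneratedBy F q ξ) : Module.finrank F (S 0) = 1 := by
  rw [congrFun (hS.eq_span_wordVectors hξ hg) 0, wordVectors_zero]
  exact finrank_span_singleton hξ.ne_zero

end IsNILDecomposition

end Decomposition

theorem mainTheorem7 {F : Type u} [Field F] (q : F) (hq0 : q ≠ 0)
    (hq : ∀ n : ℕ, 0 < n → q ^ n ≠ 1) :
    -- a NIL module exists
    (∃ (U : Type u) (_ : AddCommGroup U) (_ : Module F U) (_ : Module (SquareAlgebra F q) U)
      (_ : IsScalarTower F (SquareAlgebra F q) U), IsNILModule F q U) ∧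
    ∀ (U : Type v) [AddCommGroup U] [Module F U] [Module (SquareAlgebra F q) U]
      [IsScalarTower F (SquareAlgebra F q) U], IsNILModule F q U →
      -- it is unique up to isomorphism
      (∀ (V : Type w) [AddCommGroup V] [Module F V] [Module (SquareAlgebra F q) V]
        [IsScalarTower F (SquareAlgebra F q) V], IsNILModule F q V →
        Nonempty (U ≃ₗ[SquareAlgebra F q] V)) ∧
      -- it has a unique decomposition, described as follows
      (∃! S : ℕ → Submodule F U, IsNILDecomposition F q S) ∧
      ∀ S : ℕ → Submodule F U, IsNILDecomposition F q S →
        Module.finrank F (S 0) = 1 ∧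
        (∀ ξ : U, (ξ ∈ S 0 ∧ ξ ≠ 0) ↔ IsNILVector F q ξ) ∧
        (∀ ξ : U, IsNILVector F q ξ → IsGeneratedBy F q ξ) ∧
        ∀ ξ : U, IsNILVector F q ξ →
          ∀ n : ℕ, S n = Submodule.span F (wordVectors F q ξ n) := by
  have : IsGeneric q := ⟨hq0, hq⟩
  refine ⟨⟨UqPlus F q, inferInstance, inferInstance, inferInstance, inferInstance, 1,
    UqPlus.isNILVector_one, UqPlus.isGeneratedBy_one⟩, ?_⟩
  rintro U _ _ _ _ ⟨ξ, hξ, hg⟩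
  have hgen (ζ : U) (hζ : IsNILVector F q ζ) : IsGeneratedBy F q ζ := hζ.isGeneratedBy hξ hg
  refine ⟨?_, ?_, fun S hS => ⟨hS.finrank_zero hξ hg, fun ζ => ⟨?_, ?_⟩, hgen, ?_⟩⟩
  · rintro V _ _ _ _ ⟨ζ, hζ, hgζ⟩
    exact ⟨(hξ.orbitEquiv hg).symm.trans (hζ.orbitEquiv hgζ)⟩
  · exact ⟨_, hξ.isNILDecomposition_span_wordVectors hg,
      fun S hS => hS.eq_span_wordVectors hξ hg⟩
  · exact fun ⟨hmem, hne⟩ => hS.isNILVector hmem hne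
  · exact fun hζ => ⟨hS.mem_zero hζ (hgen ζ hζ), hζ.ne_zero⟩
  · exact fun ζ hζ n => congrFun (hS.eq_span_wordVectors hζ (hgen ζ hζ)) n
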